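/- **Theorem.** *Network.* Let $\mathcal G=(\mathcal V,\mathcal E)$ be a finite connected directed graph, without loops or multiple edges, in which every edge $e=(v,w)$ occurs together with its reverse $\tilde e=(w,v)$, and let $B$ be its incidence matrix ($B_{v,e}=1$ if $e$ enters $v$, $-1$ if $e$ exits $v$, $0$ otherwise). Let $Q=(q_{w,k})_{w,k\in\mathcal V}$ satisfy $q_{w,k}\ge 0$ and $\sum_w q_{w,k}=1$ for all $k$, and $q_{w,k}>0$ for some $w\ne k$. Let $d_e,b_e>0$ for $e\in\mathcal E$, $\beta>0$, $\tau\ge1$, $\varepsilon_{\min}>0$, $0<l_m\le l_M<1$, and integers $n_e\ge 1$. For every edge $e$ and stage $r\ge2$ let $p_e^{(r)}:[0,\infty)\to[0,1]$ and $\phi_e^{(r)}:[0,\infty)\to[l_m,l_M]$ be continuous and non-decreasing, with $p_e^{(r)}(1)=0$. *Flows.* For weights $x\in[0,\infty)^{\mathcal V}$ put $U(x)=Q\,\mathrm{diag}(x)-\mathrm{diag}(x)$. For a flow matrix $F\in[0,\infty)^{\mathcal E\times\mathcal V}$ with total edge flows $f_e=\sum_k F_{e,k}$ and for capacities $\bar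 f$, let $$c_f(F,\bar f)=\sum_{e\in\mathcal E}\Big(d_ef_e+\tfrac{b_e}{\beta+1}\,\bar f_e\,(f_e/\bar f_e)^{\beta+1}\Big).$$ A Wardrop flow for $(x,\bar f)$ is a minimizer of $c_f(\cdot,\bar f)$ over the $F\ge0$ with $BF=U(x)$; its total edge flows are unique. Let $g_e(x)$ be the total flow on $e$ when, for all $k\neq w$, the traffic $q_{w,k}x_k$ from $k$ to $w$ is split equally among all shortest paths from $k$ to $w$ with respect to the edge lengths $d$. *Cascade.* Stage $0$ has the capacities $\bar f^{(0)}_e=\max\{\varepsilon_{\min}\sum_v x_v,\ \tau g_e(x),\ \tau g_{\tilde e}(x)\}$. In stage $1$ an edge $e_1$, uniform on $\mathcal E$, is disrupted: $\bar f^{(1)}_{e_1}=\phi_{init}\bar f^{(0)}_{e_1}$ with a random $\phi_{init}\in[l_m,l_M]$, and the other capacities do not change. In stage $r\ge 2$ every edge $e$ that has been disrupted fewer than $n_e$ times so far (stage $1$ included) and whose exceedance $\psi_e=f_e^{(r-1)}/\bar f_e^{(r-1)}$ is larger than $1$ is disrupted with probability $p_e^{(r)}(\psi_e)$, independently of all else,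 and then $\bar f_e^{(r)}=\phi_e^{(r)}(\psi_e)\bar f_e^{(r-1)}$; the capacities of all other edges stay as they are. Here $F^{(r)}$ is a Wardrop flow for $(x,\bar f^{(r)})$ and $f^{(r)}$ its total edge flows. The cascade terminates, and everything stays constant from then on, at the first stage without disruption; this happens after finitely many stages. The congestion cost is $\Delta c_f^{(r)}=c_f(F^{(r)},\bar f^{(r)})-c_f(F^{(0)},\bar f^{(0)})$, and $\Delta c_f^{(end)}$ is its value at termination. *Claim.* Let $K,\alpha>0$, and let the weights $X_v\ge0$, $v\in\mathcal V$, be independent random variables with $\mathbb P(X_v>x)\sim Kx^{-\alpha}$ as $x\to\infty$ for every $v$. Run the cascade with weights $X$, where the initial edge, $\phi_{init}$ and the random choices of disruptions are independent of each other and of $X$ in the above sense. Then: 1. For every $r\ge1$, $\ \mathbb P(\Delta c_f^{(r)}>y)\sim C^{(r)}y^{-\alpha}$ as $y\to\infty$, where $$C^{(r)}=K\sum_{v\in\mathcal V}\mathbb E\big[(\Delta c_f^{(r)})^\alpha\,\big|\,X_v=1,\ X_w=0\text{ for all }w\neq v\big]\in(0,\infty);$$ the conditional expectation is that of the cascade run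 with the weight vector equal to the unit vector of $v$. 2. The limit $C^{(end)}=\lim_{r\to\infty}C^{(r)}$ exists and is positive, and $\ \mathbb P(\Delta c_f^{(end)}>y)\sim C^{(end)}y^{-\alpha}$ as $y\to\infty$. -/

import Mathlib

open Filter Topology MeasureTheory ProbabilityTheory Asymptotics

/-- The set of directed edges of a finite graph carries the discrete sigma-algebra. -/
instance SimpleGraph.Dart.discreteMeasurableSpace {V : Type*} (G : SimpleGraph V) :
    MeasurableSpace G.Dart := ⊤

/-- The deterministic data of the traffic network and of the congestion mechanism. The road network
is a symmetric, connected, directed graph: every edge of the simple graph `graph` is present in both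
directions, so the directed edges are the darts of `graph`. -/
structure TrafficModel (V : Type*) [Fintype V] where
  /-- the road network -/
  graph : SimpleGraph V
  connected : graph.Connected
  /-- travel factor matrix: `Q w k` is the fraction of the traffic originating at `k` that
  travels to `w` -/
  Q : Matrix V V ℝ
  Q_nonneg : ∀ w k, 0 ≤ Q w k
  Q_sum : ∀ k, ∑ w, Q w k = 1
  /-- free-flow travel times -/
  d : graph.Dart → ℝ
  d_pos : ∀ e, 0 < d e
  /-- congestion parameters of the edges -/
  b : graph.Dart → ℝ
  b_pos : ∀ e, 0 < b e
  /-- global congestion exponent -/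
  β : ℝ
  β_pos : 0 < β
  /-- planning slack -/
  τ : ℝ
  one_le_τ : 1 ≤ τ
  /-- minimal capacity, as a fraction of the total weight -/
  εmin : ℝ
  εmin_pos : 0 < εmin
  /-- lower bound of all capacity reduction factors -/
  lm : ℝ
  /-- upper bound of all capacity reduction factors -/
  lM : ℝ
  lm_pos : 0 < lm
  lm_le_lM : lm ≤ lM
  lM_lt_one : lM < 1
  /-- `p r e ψ`: the probability that the overloaded edge `e` is disrupted in stage `r` when its
  relative exceedance is `ψ` -/
  p : ℕ → graph.Dart → ℝ → ℝ
  p_mem : ∀ r e, ∀ ψ, 0 ≤ ψ → p r e ψ ∈ Set.Icc (0 : ℝ) 1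
  p_cont : ∀ r e, ContinuousOn (p r e) (Set.Ici 0)
  p_mono : ∀ r e, MonotoneOn (p r e) (Set.Ici 0)
  /-- the disruption probability vanishes when the edge is just at its capacity -/
  p_one : ∀ r e, p r e 1 = 0
  /-- `φ r e ψ`: the factor by which the capacity of `e` is multiplied when `e` is disrupted in
  stage `r` with relative exceedance `ψ` -/
  φ : ℕ → graph.Dart → ℝ → ℝ
  φ_mem : ∀ r e, ∀ ψ, 0 ≤ ψ → φ r e ψ ∈ Set.Icc lm lM
  φ_cont : ∀ r e, ContinuousOn (φ r e) (Set.Ici 0)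
  φ_mono : ∀ r e, MonotoneOn (φ r e) (Set.Ici 0)
  /-- maximal number of disruptions of an edge -/
  n : graph.Dart → ℕ
  n_pos : ∀ e, 1 ≤ n e

namespace TrafficModel

noncomputable section

open scoped Classical

variable {V : Type*} [Fintype V] (M : TrafficModel V)

/-- The directed edges. -/
abbrev Edge : Type _ := M.graph.Dart

/-! ### Flows -/

/-- The incidence matrix: `1` if `e` enters `v`, `-1` if `e` exits `v`, `0` otherwise. -/
def incidence : Matrix V M.Edge ℝ :=
  fun v e => if e.snd = v then 1 else if e.fst = v then -1 else 0

/-- The net travel matrix `Q S - S` with `S = diag x`. -/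
def netTravel (x : V → ℝ) : Matrix V V ℝ :=
  M.Q * Matrix.diagonal x - Matrix.diagonal x

/-- The total flow on every edge, summed over the commodities. -/
def totalFlow (F : Matrix M.Edge V ℝ) (e : M.Edge) : ℝ := ∑ k, F e k

/-- The flow cost of the flow matrix `F` for the edge capacities `c`. -/
def flowCost (F : Matrix M.Edge V ℝ) (c : M.Edge → ℝ) : ℝ :=
  ∑ e, (M.d e * M.totalFlow F e +
    M.b e / (M.β + 1) * c e * (M.totalFlow F e / c e) ^ (M.β + 1))

/-- Nonnegative flow matrices that meet the net travel requirement `U`. -/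
def IsFeasible (U : Matrix V V ℝ) (F : Matrix M.Edge V ℝ) : Prop :=
  (∀ e k, 0 ≤ F e k) ∧ M.incidence * F = U

/-- `F` is a Wardrop user equilibrium: it minimizes the flow cost among the feasible flows. -/
def IsWardrop (U : Matrix V V ℝ) (c : M.Edge → ℝ) (F : Matrix M.Edge V ℝ) : Prop :=
  M.IsFeasible U F ∧ ∀ F', M.IsFeasible U F' → M.flowCost F c ≤ M.flowCost F' c

/-- A Wardrop user equilibrium for net travel `U` and capacities `c`. For the `U` and `c` that occur
in the model one exists, and all of them have the same total flow on every edge (the cost is strictly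
convex in the total flow); the capacities, exceedances and costs below depend on it only through the
total flow. -/
def wardrop (U : Matrix V V ℝ) (c : M.Edge → ℝ) : Matrix M.Edge V ℝ :=
  Classical.epsilon (M.IsWardrop U c)

/-! ### Shortest path flow and initial capacities -/

/-- The free-flow travel time along a walk. -/
def walkCost {v w : V} (q : M.graph.Walk v w) : ℝ := (q.darts.map M.d).sum

/-- The shortest walks from `v` to `w` (a finite nonempty set of paths). -/
def shortest (v w : V) : Set (M.graph.Walk v w) :=
  {q | ∀ q' : M.graph.Walk v w, M.walkCost q ≤ M.walkCost q'}

/-- The shortest path flow: the traffic from `k` to `w`, of size `Q w k * x k`, is split equally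
among all shortest paths from `k` to `w`. This is the Wardrop flow for infinite capacities. -/
def shortestFlow (x : V → ℝ) : Matrix M.Edge V ℝ :=
  fun e k => ∑ w, M.Q w k * x k *
    (({q ∈ M.shortest k w | e ∈ q.darts}.ncard : ℝ) / ((M.shortest k w).ncard : ℝ))

/-- The capacities before the cascade. -/
def capacity₀ (x : V → ℝ) (e : M.Edge) : ℝ :=
  max (M.εmin * ∑ v, x v)
    (max (M.τ * M.totalFlow (M.shortestFlow x) e) (M.τ * M.totalFlow (M.shortestFlow x) e.symm))

/-! ### The cascade -/

/-- The state of the network after a stage of the cascade: the capacities, the number of times each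
edge has been disrupted so far, and the set of edges disrupted in this stage. -/
structure Stage where
  capacity : M.Edge → ℝ
  count : M.Edge → ℕ
  disrupted : Set M.Edge

/-- The Wardrop flow in a given state, for the weights `x`. -/
def stageFlow (x : V → ℝ) (s : M.Stage) : Matrix M.Edge V ℝ :=
  M.wardrop (M.netTravel x) s.capacity

/-- The relative flow exceedance. -/
def exceedance (x : V → ℝ) (s : M.Stage) (e : M.Edge) : ℝ :=
  M.totalFlow (M.stageFlow x s) e / s.capacity e

/-- The edges disrupted in stage `r`, when the previous stage is `s`: if the cascade has not
terminated (some edge was disrupted in the previous stage), every overloaded edge that has not yet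
been disrupted the maximal number of times is disrupted with probability `p r e ψ`, which is realized
by comparing with a mark `ξ e`, to be taken uniform on `[0, 1]`. -/
def newDisrupted (x : V → ℝ) (ξ : M.Edge → ℝ) (r : ℕ) (s : M.Stage) : Set M.Edge :=
  {e | s.disrupted.Nonempty ∧ s.count e < M.n e ∧ 1 < M.exceedance x s e ∧
    ξ e < M.p r e (M.exceedance x s e)}

/-- The passage to the next stage, in which the edges in `D` are disrupted. -/
def nextStage (x : V → ℝ) (r : ℕ) (s : M.Stage) (D : Set M.Edge) : M.Stage where
  capacity e := if e ∈ D then M.φ r e (M.exceedance x s e) * s.capacity e else s.capacity e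
  count e := if e ∈ D then s.count e + 1 else s.count e
  disrupted := D

/-- The cascade for the vertex weights `x`, initial reduction factor `u`, initial edge `e₁` and marks
`ξ (r, e)` for stage `r` and edge `e`. Stage `0` is the undisturbed network, in stage `1` the edge
`e₁` is disrupted. After a stage without disruption nothing changes any more. -/
def cascade (x : V → ℝ) (u : ℝ) (e₁ : M.Edge) (ξ : ℕ × M.Edge → ℝ) : ℕ → M.Stage
  | 0 => { capacity := M.capacity₀ x, count := fun _ => 0, disrupted := ∅ }
  | 1 =>
    { capacity := fun e => if e = e₁ then u * M.capacity₀ x e else M.capacity₀ x e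
      count := fun e => if e = e₁ then 1 else 0
      disrupted := {e₁} }
  | r + 2 =>
    M.nextStage x (r + 2) (cascade x u e₁ ξ (r + 1))
      (M.newDisrupted x (fun e => ξ (r + 2, e)) (r + 2) (cascade x u e₁ ξ (r + 1)))

/-- The flow cost in a given state. -/
def stageCost (x : V → ℝ) (s : M.Stage) : ℝ := M.flowCost (M.stageFlow x s) s.capacity

/-- The congestion cost at stage `r`. -/
def congestionCost (x : V → ℝ) (u : ℝ) (e₁ : M.Edge) (ξ : ℕ × M.Edge → ℝ) (r : ℕ) : ℝ :=
  M.stageCost x (M.cascade x u e₁ ξ r) - M.stageCost x (M.cascade x u e₁ ξ 0)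

/-- The stage at which the cascade terminates: the first stage `r ≥ 1` without disruption. (It exists
and is at most `1 + ∑ e, n e`, because `e` is disrupted at most `n e` times.) -/
def endStage (x : V → ℝ) (u : ℝ) (e₁ : M.Edge) (ξ : ℕ × M.Edge → ℝ) : ℕ :=
  sInf {r | 1 ≤ r ∧ (M.cascade x u e₁ ξ r).disrupted = ∅}

/-- The congestion cost of the whole cascade. -/
def congestionCostEnd (x : V → ℝ) (u : ℝ) (e₁ : M.Edge) (ξ : ℕ × M.Edge → ℝ) : ℝ :=
  M.congestionCost x u e₁ ξ (M.endStage x u e₁ ξ)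

/-! ### Randomness -/

variable {Ω : Type*} [MeasurableSpace Ω]

/-- The randomness of the cascade other than the vertex weights: the initial reduction factor `u`
takes values in `[lm, lM]`, the initial edge `e₁` is uniform on the edges, the marks `ξ i` are uniform
on `[0, 1]`, and all of these are mutually independent. -/
structure IsCascadeNoise (μ : Measure Ω) (u : Ω → ℝ) (e₁ : Ω → M.Edge)
    (ξ : ℕ × M.Edge → Ω → ℝ) : Prop where
  measurable_u : Measurable u
  measurable_e₁ : Measurable e₁
  measurable_ξ : ∀ i, Measurable (ξ i)
  u_mem : ∀ᵐ ω ∂μ, u ω ∈ Set.Icc M.lm M.lM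
  e₁_uniform : ∀ e, μ {ω | e₁ ω = e} = (Nat.card M.Edge : ENNReal)⁻¹
  ξ_uniform : ∀ i, μ.map (ξ i) = volume.restrict (Set.Icc (0 : ℝ) 1)
  indep_ξ : iIndepFun ξ μ
  indep_e₁ : IndepFun e₁ (fun ω i => ξ i ω) μ
  indep_u : IndepFun u (fun ω => (e₁ ω, fun i => ξ i ω)) μ

/-- The congestion cost at stage `r` when the weights are `e_v`: weight `1` at `v` and `0` at all
other vertices. As the noise is independent of the weights, its law is the conditional law of the
congestion cost given that the weight vector is `e_v`. -/
def unitCost (v : V) (u : Ω → ℝ) (e₁ : Ω → M.Edge) (ξ : ℕ × M.Edge → Ω → ℝ) (r : ℕ) (ω : Ω) : ℝ :=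
  M.congestionCost (Pi.single v 1) (u ω) (e₁ ω) (fun i => ξ i ω) r

/-- The constant `C⁽ʳ⁾ = K ∑ᵥ E[(Δc⁽ʳ⁾)^α | X = e_v]`. -/
def tailConst (μ : Measure Ω) (K α : ℝ) (u : Ω → ℝ) (e₁ : Ω → M.Edge)
    (ξ : ℕ × M.Edge → Ω → ℝ) (r : ℕ) : ℝ :=
  K * ∑ v, ∫ ω, M.unitCost v u e₁ ξ r ω ^ α ∂μ

end

end TrafficModel

/-! The proof is a single-big-jump argument. Freeze all randomness except the weights. Scaling
nonzero weights by t > 0 scales the net travel, the capacities and the Wardrop flows by t and leaves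
every exceedance unchanged, so the same marks disrupt the same edges. The congestion cost h is
therefore positively homogeneous of degree one (`congestionCost_smul`). It is nonnegative and at
most C ∑ x_v with C independent of the noise (`exists_congestionCost_le`), because the stage-r
capacities stay above lm^r εmin ∑ x_v.

Two independent weights both exceed multiples of y with probability o(y^(-α)). So h(X) > y is
essentially caused by one large X_v, and then h(X) ≈ X_v h(e_v), provided h is continuous at the
unit vector e_v within the orthant. This gives the constant K ∑ h(e_v)^α
(`tendsto_rpow_mul_tail_homogeneous`); dominated convergence over the independent noise turns it
into C^(r).

Continuity at e_v is the delicate point. Wardrop flows are continuous by compactness and uniqueness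
of the total flows (`continuousOn_wardropFlow`). A disruption jumps only where a mark equals its
disruption probability; p(1) = 0 makes the threshold at exceedance 1 harmless. At e_v, for a given
reduction factor, only finitely many probabilities can occur, so a uniform mark almost surely avoids
them (`tendsto_cascade`, `IsCascadeNoise.ae_isRegularMark`).

C^(r) > 0 because some edge carries flow under a suitable e_v and is the initial edge with positive
probability. Since edge e is disrupted at most n_e times, every cascade has stopped by one
deterministic stage, so the second claim is the first one at that stage. -/

namespace TrafficModel

/-! ### Edge costs, feasible flows and the Wardrop equilibrium -/

section Flows

open scoped Classical

variable {V : Type*} [Fintype V] (M : TrafficModel V)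

/-- The cost of the flow `f` on an edge of capacity `c`. -/
noncomputable def edgeCost (e : M.Edge) (f c : ℝ) : ℝ :=
  M.d e * f + M.b e / (M.β + 1) * c * (f / c) ^ (M.β + 1)

lemma flowCost_eq_sum_edgeCost (F : Matrix M.Edge V ℝ) (c : M.Edge → ℝ) :
    M.flowCost F c = ∑ e, M.edgeCost e (M.totalFlow F e) (c e) := rfl

lemma b_div_pos (e : M.Edge) : 0 < M.b e / (M.β + 1) :=
  div_pos (M.b_pos e) (by linarith [M.β_pos])

lemma mul_le_edgeCost (e : M.Edge) {f c : ℝ} (hf : 0 ≤ f) (hc : 0 ≤ c) :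
    M.d e * f ≤ M.edgeCost e f c := by
  have := M.b_div_pos e
  unfold edgeCost
  have : 0 ≤ M.b e / (M.β + 1) * c * (f / c) ^ (M.β + 1) := by positivity
  linarith

lemma edgeCost_nonneg (e : M.Edge) {f c : ℝ} (hf : 0 ≤ f) (hc : 0 ≤ c) :
    0 ≤ M.edgeCost e f c :=
  (mul_nonneg (M.d_pos e).le hf).trans (M.mul_le_edgeCost e hf hc)

lemma edgeCost_zero (e : M.Edge) (c : ℝ) : M.edgeCost e 0 c = 0 := by
  have : M.β + 1 ≠ 0 := by linarith [M.β_pos]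
  simp [edgeCost, Real.zero_rpow this]

lemma edgeCost_mul (e : M.Edge) {t : ℝ} (ht : t ≠ 0) (f c : ℝ) :
    M.edgeCost e (t * f) (t * c) = t * M.edgeCost e f c := by
  unfold edgeCost
  rw [mul_div_mul_left _ _ ht]
  ring

lemma edgeCost_mono (e : M.Edge) {f f' c : ℝ} (hf : 0 ≤ f) (hff : f ≤ f') (hc : 0 ≤ c) :
    M.edgeCost e f c ≤ M.edgeCost e f' c := by
  have := M.b_div_pos e
  have := M.d_pos e
  have := M.β_pos
  unfold edgeCost
  gcongr

/-- Isolates the capacity as a negative power, from which monotonicity of the congestion term in the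
capacity is immediate. -/
lemma mul_div_rpow (β : ℝ) {f c : ℝ} (hf : 0 ≤ f) (hc : 0 < c) :
    c * (f / c) ^ (β + 1) = f ^ (β + 1) * c ^ (-β) := by
  rw [Real.div_rpow hf hc.le, Real.rpow_add_one hc.ne', Real.rpow_neg hc.le]
  have := (Real.rpow_pos_of_pos hc β).ne'
  field_simp

lemma edgeCost_antitone (e : M.Edge) {f c c' : ℝ} (hf : 0 ≤ f) (hc : 0 < c) (hcc : c ≤ c') :
    M.edgeCost e f c' ≤ M.edgeCost e f c := by
  have h1 := M.b_div_pos e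
  have h2 := M.β_pos
  unfold edgeCost
  rw [mul_assoc, mul_assoc, mul_div_rpow _ hf hc, mul_div_rpow _ hf (hc.trans_le hcc)]
  have := Real.rpow_le_rpow_of_nonpos hc hcc (neg_nonpos.2 h2.le)
  gcongr

lemma edgeCost_strictAnti (e : M.Edge) {f c c' : ℝ} (hf : 0 < f) (hc : 0 < c) (hcc : c < c') :
    M.edgeCost e f c' < M.edgeCost e f c := by
  have h1 := M.b_div_pos e
  have h2 := M.β_pos
  unfold edgeCost
  rw [mul_assoc, mul_assoc, mul_div_rpow _ hf.le hc, mul_div_rpow _ hf.le (hc.trans hcc)]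
  have := Real.rpow_lt_rpow_of_neg hc hcc (neg_neg_iff_pos.2 h2)
  gcongr

lemma strictConvexOn_edgeCost (e : M.Edge) {c : ℝ} (hc : 0 < c) :
    StrictConvexOn ℝ (Set.Ici 0) fun f => M.edgeCost e f c := by
  have h1 := M.b_div_pos e
  have h2 := M.β_pos
  have h3 := strictConvexOn_rpow (p := M.β + 1) (by linarith)
  refine ⟨convex_Ici 0, fun f hf f' hf' hne s t hs ht hst => ?_⟩
  have h4 := h3.2 (x := f / c) (y := f' / c) (div_nonneg hf hc.le) (div_nonneg hf' hc.le)
    (fun h => hne (by field_simp at h; exact h)) hs ht hst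
  simp only [edgeCost, smul_eq_mul] at h4 ⊢
  have h5 : (s * f + t * f') / c = s * (f / c) + t * (f' / c) := by ring
  rw [h5]
  have h6 := mul_lt_mul_of_pos_left h4 (mul_pos h1 hc)
  linarith

lemma continuousAt_edgeCost (e : M.Edge) {q : ℝ × ℝ} (hq : 0 < q.2) :
    ContinuousAt (fun q : ℝ × ℝ => M.edgeCost e q.1 q.2) q := by
  have h2 := M.β_pos
  unfold edgeCost
  have h3 : ContinuousAt (fun q : ℝ × ℝ => q.1 / q.2) q :=
    continuousAt_fst.div continuousAt_snd hq.ne'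
  have h4 := h3.rpow_const (p := M.β + 1) (Or.inr (by linarith))
  fun_prop

lemma continuous_edgeCost_left (e : M.Edge) (c : ℝ) : Continuous fun f => M.edgeCost e f c := by
  have h2 := M.β_pos
  unfold edgeCost
  have : Continuous fun f : ℝ => (f / c) ^ (M.β + 1) :=
    (continuous_id.div_const c).rpow_const fun _ => Or.inr (by linarith)
  fun_prop

lemma totalFlow_nonneg {F : Matrix M.Edge V ℝ} (hF : ∀ e k, 0 ≤ F e k) (e : M.Edge) :
    0 ≤ M.totalFlow F e :=
  Finset.sum_nonneg fun k _ => hF e k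

lemma totalFlow_smul (t : ℝ) (F : Matrix M.Edge V ℝ) (e : M.Edge) :
    M.totalFlow (t • F) e = t * M.totalFlow F e := by
  simp [totalFlow, Finset.mul_sum]

lemma totalFlow_add (F F' : Matrix M.Edge V ℝ) (e : M.Edge) :
    M.totalFlow (F + F') e = M.totalFlow F e + M.totalFlow F' e := by
  simp [totalFlow, Finset.sum_add_distrib]

lemma flowCost_smul {t : ℝ} (ht : t ≠ 0) (F : Matrix M.Edge V ℝ) (c : M.Edge → ℝ) :
    M.flowCost (t • F) (t • c) = t * M.flowCost F c := by
  simp only [flowCost_eq_sum_edgeCost, totalFlow_smul, Pi.smul_apply, smul_eq_mul,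
    M.edgeCost_mul _ ht, Finset.mul_sum]

lemma flowCost_antitone {F : Matrix M.Edge V ℝ} (hF : ∀ e k, 0 ≤ F e k) {c c' : M.Edge → ℝ}
    (hc : ∀ e, 0 < c e) (hcc : ∀ e, c e ≤ c' e) : M.flowCost F c' ≤ M.flowCost F c :=
  Finset.sum_le_sum fun e _ => M.edgeCost_antitone e (M.totalFlow_nonneg hF e) (hc e) (hcc e)

/-- Coercivity: the free-flow term alone controls every entry of the flow matrix, uniformly in the
capacities. All compactness arguments rest on this. -/
lemma mul_le_flowCost {F : Matrix M.Edge V ℝ} (hF : ∀ e k, 0 ≤ F e k) {c : M.Edge → ℝ}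
    (hc : ∀ e, 0 ≤ c e) (e : M.Edge) (k : V) : M.d e * F e k ≤ M.flowCost F c := by
  calc M.d e * F e k ≤ M.d e * M.totalFlow F e :=
        mul_le_mul_of_nonneg_left
          (Finset.single_le_sum (fun k _ => hF e k) (Finset.mem_univ k)) (M.d_pos e).le
    _ ≤ M.edgeCost e (M.totalFlow F e) (c e) :=
        M.mul_le_edgeCost e (M.totalFlow_nonneg hF e) (hc e)
    _ ≤ M.flowCost F c :=
        Finset.single_le_sum
          (f := fun e => M.edgeCost e (M.totalFlow F e) (c e))
          (fun e _ => M.edgeCost_nonneg e (M.totalFlow_nonneg hF e) (hc e)) (Finset.mem_univ e)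

lemma continuous_totalFlow (e : M.Edge) : Continuous fun F : Matrix M.Edge V ℝ => M.totalFlow F e :=
  continuous_finsetSum _ fun k _ => (continuous_apply k).comp (continuous_apply e)

lemma continuous_flowCost_left (c : M.Edge → ℝ) : Continuous fun F => M.flowCost F c :=
  continuous_finsetSum _ fun e _ =>
    (M.continuous_edgeCost_left e (c e)).comp (M.continuous_totalFlow e)

lemma tendsto_flowCost {ι : Type*} {l : Filter ι} {F : ι → Matrix M.Edge V ℝ}
    {c : ι → M.Edge → ℝ} {F₀ : Matrix M.Edge V ℝ} {c₀ : M.Edge → ℝ} (hF : Tendsto F l (𝓝 F₀))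
    (hc : Tendsto c l (𝓝 c₀)) (hc₀ : ∀ e, 0 < c₀ e) :
    Tendsto (fun i => M.flowCost (F i) (c i)) l (𝓝 (M.flowCost F₀ c₀)) := by
  refine tendsto_finsetSum _ fun e _ => ?_
  have h1 : Tendsto (fun i => (M.totalFlow (F i) e, c i e)) l (𝓝 (M.totalFlow F₀ e, c₀ e)) :=
    (((M.continuous_totalFlow e).tendsto _).comp hF).prodMk_nhds
      (((continuous_apply e).tendsto _).comp hc)
  exact (M.continuousAt_edgeCost e (q := (M.totalFlow F₀ e, c₀ e)) (hc₀ e)).tendsto.comp h1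

lemma incidence_apply (v : V) (e : M.Edge) :
    M.incidence v e = (if e.snd = v then 1 else 0) - if e.fst = v then 1 else 0 := by
  unfold incidence
  have := e.fst_ne_snd
  split_ifs with h1 h2 <;> simp_all

lemma netTravel_apply (x : V → ℝ) (w k : V) :
    M.netTravel x w k = x k * (M.Q w k - if w = k then 1 else 0) := by
  simp only [netTravel, Matrix.sub_apply, Matrix.mul_diagonal, Matrix.diagonal_apply]
  split_ifs with h
  · subst h; ring
  · ring

lemma netTravel_smul (t : ℝ) (x : V → ℝ) : M.netTravel (t • x) = t • M.netTravel x := by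
  ext w k
  simp [netTravel_apply, mul_assoc]

/-- Telescoping along the walk; repeated edges and closed walks do no harm, as edges are counted
with multiplicity. -/
lemma sum_incidence_mul_count {k w : V} (q : M.graph.Walk k w) (v : V) :
    ∑ e, M.incidence v e * (q.darts.count e : ℝ) =
      (if w = v then 1 else 0) - if k = v then 1 else 0 := by
  induction q with
  | nil => simp
  | cons h q ih =>
    simp only [SimpleGraph.Walk.darts_cons, List.count_cons, Nat.cast_add, mul_add,
      Finset.sum_add_distrib, ih]
    simp [incidence_apply]

/-- A feasible flow for unit weights, along arbitrarily chosen walks. -/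
noncomputable def unitFlow : Matrix M.Edge V ℝ := fun e k =>
  ∑ w, M.Q w k * ((M.connected.preconnected k w).some.darts.count e : ℝ)

lemma unitFlow_nonneg (e : M.Edge) (k : V) : 0 ≤ M.unitFlow e k :=
  Finset.sum_nonneg fun w _ => mul_nonneg (M.Q_nonneg w k) (Nat.cast_nonneg _)

lemma sum_incidence_mul_unitFlow (v k : V) :
    ∑ e, M.incidence v e * M.unitFlow e k = M.Q v k - if v = k then 1 else 0 := by
  simp only [unitFlow, Finset.mul_sum, mul_left_comm (M.incidence _ _)]
  rw [Finset.sum_comm]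
  simp only [← Finset.mul_sum, sum_incidence_mul_count, mul_sub, Finset.sum_sub_distrib,
    ← Finset.sum_mul, M.Q_sum]
  simp [eq_comm]

lemma isFeasible_netTravel_iff {x : V → ℝ} {F : Matrix M.Edge V ℝ} :
    M.IsFeasible (M.netTravel x) F ↔ (∀ e k, 0 ≤ F e k) ∧
      ∀ v k, ∑ e, M.incidence v e * F e k = x k * (M.Q v k - if v = k then 1 else 0) := by
  simp only [IsFeasible, ← Matrix.ext_iff, Matrix.mul_apply, netTravel_apply]

/-- A feasible flow for the weights `x`, along arbitrarily chosen walks. -/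
noncomputable def walkFlow (x : V → ℝ) : Matrix M.Edge V ℝ := fun e k => x k * M.unitFlow e k

lemma isFeasible_walkFlow {x : V → ℝ} (hx : 0 ≤ x) :
    M.IsFeasible (M.netTravel x) (M.walkFlow x) := by
  refine M.isFeasible_netTravel_iff.2
    ⟨fun e k => mul_nonneg (hx k) (M.unitFlow_nonneg e k), fun v k => ?_⟩
  simp only [walkFlow, mul_left_comm (M.incidence _ _), ← Finset.mul_sum,
    sum_incidence_mul_unitFlow]

lemma isClosed_setOf_isFeasible (U : Matrix V V ℝ) : IsClosed {F | M.IsFeasible U F} := by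
  simp only [IsFeasible, Set.ofPred_and, Set.ofPred_forall]
  refine IsClosed.inter (isClosed_iInter fun e => isClosed_iInter fun k => ?_) ?_
  · exact isClosed_le continuous_const ((continuous_apply k).comp (continuous_apply e))
  · exact isClosed_eq (continuous_const.matrix_mul continuous_id) continuous_const

/-- A compact set containing all flows of cost at most `R`. -/
noncomputable def costBox (R : ℝ) : Set (Matrix M.Edge V ℝ) :=
  Set.pi Set.univ fun e => Set.pi Set.univ fun _ => Set.Icc 0 (R / M.d e)

lemma isCompact_costBox (R : ℝ) : IsCompact (M.costBox R) :=
  isCompact_univ_pi fun _ => isCompact_univ_pi fun _ => isCompact_Icc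

lemma mem_costBox {R : ℝ} {F : Matrix M.Edge V ℝ} (hF : ∀ e k, 0 ≤ F e k) {c : M.Edge → ℝ}
    (hc : ∀ e, 0 ≤ c e) (hR : M.flowCost F c ≤ R) : F ∈ M.costBox R := by
  refine fun e _ k _ => ⟨hF e k, ?_⟩
  rw [le_div_iff₀ (M.d_pos e), mul_comm]
  exact (M.mul_le_flowCost hF hc e k).trans hR

/-- By coercivity the feasible flows at most as expensive as `walkFlow` lie in a compact box, and a
minimizer there beats all more expensive flows as well. -/
lemma exists_isWardrop {x : V → ℝ} (hx : 0 ≤ x) {c : M.Edge → ℝ} (hc : ∀ e, 0 ≤ c e) :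
    ∃ F, M.IsWardrop (M.netTravel x) c F := by
  have hG := M.isFeasible_walkFlow hx
  have hK : IsCompact ({F | M.IsFeasible (M.netTravel x) F} ∩
      M.costBox (M.flowCost (M.walkFlow x) c)) :=
    (M.isCompact_costBox _).inter_left (M.isClosed_setOf_isFeasible _)
  obtain ⟨F, hF, hmin⟩ := hK.exists_isMinOn
    ⟨_, hG, M.mem_costBox hG.1 hc le_rfl⟩ (M.continuous_flowCost_left c).continuousOn
  refine ⟨F, hF.1, fun F' hF' => ?_⟩
  rcases le_total (M.flowCost F' c) (M.flowCost (M.walkFlow x) c) with h | h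
  · exact hmin ⟨hF', M.mem_costBox hF'.1 hc h⟩
  · exact (hmin ⟨hG, M.mem_costBox hG.1 hc le_rfl⟩).trans h

lemma isWardrop_wardrop {x : V → ℝ} (hx : 0 ≤ x) {c : M.Edge → ℝ} (hc : ∀ e, 0 ≤ c e) :
    M.IsWardrop (M.netTravel x) c (M.wardrop (M.netTravel x) c) :=
  Classical.epsilon_spec (M.exists_isWardrop hx hc)

lemma IsFeasible.midpoint {U : Matrix V V ℝ} {F F' : Matrix M.Edge V ℝ} (h : M.IsFeasible U F)
    (h' : M.IsFeasible U F') : M.IsFeasible U ((1 / 2 : ℝ) • F + (1 / 2 : ℝ) • F') := by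
  refine ⟨fun e k => ?_, ?_⟩
  · have := h.1 e k
    have := h'.1 e k
    simp only [Matrix.add_apply, Matrix.smul_apply, smul_eq_mul]
    positivity
  · rw [Matrix.mul_add, Matrix.mul_smul, Matrix.mul_smul, h.2, h'.2, ← add_smul]
    norm_num

/-- If two minimizers differed in the total flow on some edge, strict convexity of that edge's cost
would make their midpoint strictly cheaper. -/
lemma IsWardrop.totalFlow_eq {U : Matrix V V ℝ} {c : M.Edge → ℝ} (hc : ∀ e, 0 < c e)
    {F F' : Matrix M.Edge V ℝ} (h : M.IsWardrop U c F) (h' : M.IsWardrop U c F') :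
    M.totalFlow F = M.totalFlow F' := by
  by_contra hne
  obtain ⟨e₀, he₀⟩ := Function.ne_iff.1 hne
  have hlt : M.flowCost ((1 / 2 : ℝ) • F + (1 / 2 : ℝ) • F') c <
      ∑ e, ((1 / 2 : ℝ) * M.edgeCost e (M.totalFlow F e) (c e) +
        (1 / 2 : ℝ) * M.edgeCost e (M.totalFlow F' e) (c e)) := by
    rw [flowCost_eq_sum_edgeCost]
    simp only [totalFlow_add, totalFlow_smul]
    refine Finset.sum_lt_sum (fun e _ => ?_) ⟨e₀, Finset.mem_univ _, ?_⟩
    · exact (M.strictConvexOn_edgeCost e (hc e)).convexOn.2 (M.totalFlow_nonneg h.1.1 e)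
        (M.totalFlow_nonneg h'.1.1 e) (by norm_num) (by norm_num) (by norm_num)
    · exact (M.strictConvexOn_edgeCost e₀ (hc e₀)).2 (M.totalFlow_nonneg h.1.1 e₀)
        (M.totalFlow_nonneg h'.1.1 e₀) he₀ (by norm_num) (by norm_num) (by norm_num)
  rw [Finset.sum_add_distrib, ← Finset.mul_sum, ← Finset.mul_sum, ← flowCost_eq_sum_edgeCost,
    ← flowCost_eq_sum_edgeCost] at hlt
  have h1 := h.2 _ (h.1.midpoint M h'.1)
  have h2 := h'.2 _ h.1
  linarith

lemma IsFeasible.smul {U : Matrix V V ℝ} {F : Matrix M.Edge V ℝ} {t : ℝ} (ht : 0 ≤ t)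
    (h : M.IsFeasible U F) : M.IsFeasible (t • U) (t • F) := by
  refine ⟨fun e k => mul_nonneg ht (h.1 e k), ?_⟩
  rw [Matrix.mul_smul, h.2]

lemma IsWardrop.smul {U : Matrix V V ℝ} {c : M.Edge → ℝ} {F : Matrix M.Edge V ℝ} {t : ℝ}
    (ht : 0 < t) (h : M.IsWardrop U c F) : M.IsWardrop (t • U) (t • c) (t • F) := by
  refine ⟨h.1.smul M ht.le, fun F' hF' => ?_⟩
  have h1 := hF'.smul M (inv_nonneg.2 ht.le)
  rw [inv_smul_smul₀ ht.ne'] at h1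
  have h2 := mul_le_mul_of_nonneg_left (h.2 _ h1) ht.le
  rwa [← M.flowCost_smul ht.ne', ← M.flowCost_smul ht.ne', smul_inv_smul₀ ht.ne'] at h2

/-- The total edge flows of the Wardrop equilibrium for the weights `x` and capacities `c`. -/
noncomputable def wardropFlow (x : V → ℝ) (c : M.Edge → ℝ) : M.Edge → ℝ :=
  M.totalFlow (M.wardrop (M.netTravel x) c)

lemma wardropFlow_smul {x : V → ℝ} (hx : 0 ≤ x) {c : M.Edge → ℝ} (hc : ∀ e, 0 < c e) {t : ℝ}
    (ht : 0 < t) : M.wardropFlow (t • x) (t • c) = t • M.wardropFlow x c := by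
  have h1 := (M.isWardrop_wardrop hx fun e => (hc e).le).smul M ht
  rw [← netTravel_smul] at h1
  have h2 := M.isWardrop_wardrop (x := t • x) (c := t • c) (smul_nonneg ht.le hx)
    (fun e => (mul_pos ht (hc e)).le)
  have h3 := h2.totalFlow_eq M (fun e => mul_pos ht (hc e)) h1
  ext e
  rw [wardropFlow, h3, totalFlow_smul]
  rfl

/-- A perturbation of a feasible flow for the weights `x₀` to one for the weights `x`. -/
noncomputable def adjustFlow (x₀ : V → ℝ) (F : Matrix M.Edge V ℝ) (x : V → ℝ) :
    Matrix M.Edge V ℝ :=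
  fun e k => if x₀ k = 0 then F e k + x k * M.unitFlow e k else x k / x₀ k * F e k

lemma adjustFlow_self (x₀ : V → ℝ) (F : Matrix M.Edge V ℝ) : M.adjustFlow x₀ F x₀ = F := by
  ext e k
  unfold adjustFlow
  split_ifs with h
  · simp [h]
  · simp [h]

/-- Lets a competitor at the limit weights be approximated by competitors at nearby weights. Columns
with positive weight are rescaled; a column with zero weight cannot be, so a small multiple of
`unitFlow` is added instead. -/
lemma isFeasible_adjustFlow {x₀ x : V → ℝ} (hx₀ : 0 ≤ x₀) (hx : 0 ≤ x) {F : Matrix M.Edge V ℝ}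
    (hF : M.IsFeasible (M.netTravel x₀) F) :
    M.IsFeasible (M.netTravel x) (M.adjustFlow x₀ F x) := by
  rw [isFeasible_netTravel_iff] at hF ⊢
  refine ⟨fun e k => ?_, fun v k => ?_⟩
  · unfold adjustFlow
    have := hx₀ k
    have := hx k
    have := hF.1 e k
    have := M.unitFlow_nonneg e k
    split_ifs
    · simp only [Pi.zero_apply] at *; positivity
    · simp only [Pi.zero_apply] at *; positivity
  · unfold adjustFlow
    have h1 := hF.2 v k
    by_cases h : x₀ k = 0
    · simp only [h, if_true, mul_add, Finset.sum_add_distrib, h1, mul_left_comm (M.incidence _ _),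
        ← Finset.mul_sum, sum_incidence_mul_unitFlow]
      ring
    · simp only [h, if_false, mul_left_comm (M.incidence _ _), ← Finset.mul_sum, h1]
      rw [← mul_assoc, div_mul_cancel₀ _ h]

lemma continuous_adjustFlow (x₀ : V → ℝ) (F : Matrix M.Edge V ℝ) :
    Continuous (M.adjustFlow x₀ F) := by
  refine continuous_pi fun e => continuous_pi fun k => ?_
  unfold adjustFlow
  split_ifs <;> fun_prop

lemma continuous_walkFlow : Continuous M.walkFlow := by
  refine continuous_pi fun e => continuous_pi fun k => ?_
  unfold walkFlow
  fun_prop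

lemma isClosed_setOf_isFeasible_netTravel :
    IsClosed {q : (V → ℝ) × Matrix M.Edge V ℝ | M.IsFeasible (M.netTravel q.1) q.2} := by
  simp only [isFeasible_netTravel_iff, Set.ofPred_and, Set.ofPred_forall]
  refine IsClosed.inter (isClosed_iInter fun e => isClosed_iInter fun k => ?_)
    (isClosed_iInter fun v => isClosed_iInter fun k => ?_)
  · exact isClosed_le continuous_const (continuous_snd.matrix_elem e k)
  · refine isClosed_eq (continuous_finsetSum _ fun e _ => continuous_const.mul ?_) (by fun_prop)
    exact continuous_snd.matrix_elem e k

/-- The Wardrop equilibrium depends continuously on the weights and the capacities. -/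
lemma continuousOn_wardropFlow :
    ContinuousOn (fun q : (V → ℝ) × (M.Edge → ℝ) => M.wardropFlow q.1 q.2)
      {q | 0 ≤ q.1 ∧ ∀ e, 0 < q.2 e} := by
  rintro ⟨x₀, c₀⟩ ⟨hx₀, hc₀⟩
  simp only at hx₀ hc₀
  -- Along an ultrafilter, compactness gives a limit of the chosen minimizers themselves. It
  -- suffices that this limit is a minimizer, since its total flows are then forced.
  refine tendsto_iff_ultrafilter _ _ _ |>.2 fun g hg => ?_
  have hgx : Tendsto (fun q : (V → ℝ) × (M.Edge → ℝ) => q.1) g (𝓝 x₀) :=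
    (continuous_fst.tendsto (x₀, c₀)).mono_left (hg.trans nhdsWithin_le_nhds)
  have hgc : Tendsto (fun q : (V → ℝ) × (M.Edge → ℝ) => q.2) g (𝓝 c₀) :=
    (continuous_snd.tendsto (x₀, c₀)).mono_left (hg.trans nhdsWithin_le_nhds)
  have hgd : ∀ᶠ q : (V → ℝ) × (M.Edge → ℝ) in g, 0 ≤ q.1 ∧ ∀ e, 0 < q.2 e :=
    hg self_mem_nhdsWithin
  set Φ : (V → ℝ) × (M.Edge → ℝ) → Matrix M.Edge V ℝ :=
    fun q => M.wardrop (M.netTravel q.1) q.2 with hΦ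
  have hWd : ∀ᶠ q : (V → ℝ) × (M.Edge → ℝ) in g, M.IsWardrop (M.netTravel q.1) q.2 (Φ q) :=
    hgd.mono fun q hq => M.isWardrop_wardrop hq.1 fun e => (hq.2 e).le
  have hbd : ∀ᶠ q : (V → ℝ) × (M.Edge → ℝ) in g,
      M.flowCost (M.walkFlow q.1) q.2 ≤ M.flowCost (M.walkFlow x₀) c₀ + 1 :=
    (M.tendsto_flowCost ((M.continuous_walkFlow.tendsto _).comp hgx) hgc hc₀).eventually_le_const
      (lt_add_one _)
  have hbox : ∀ᶠ q in g, Φ q ∈ M.costBox (M.flowCost (M.walkFlow x₀) c₀ + 1) := by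
    filter_upwards [hgd, hWd, hbd] with q h1 h2 h3
    exact M.mem_costBox h2.1.1 (fun e => (h1.2 e).le)
      ((h2.2 _ (M.isFeasible_walkFlow h1.1)).trans h3)
  obtain ⟨F, -, hF⟩ := (M.isCompact_costBox _).ultrafilter_le_nhds (g.map Φ)
    (le_principal_iff.2 hbox)
  have hFt : Tendsto Φ g (𝓝 F) := hF
  have hFW : M.IsWardrop (M.netTravel x₀) c₀ F := by
    constructor
    · exact M.isClosed_setOf_isFeasible_netTravel.mem_of_tendsto (hgx.prodMk_nhds hFt)
        (hWd.mono fun q hq => hq.1)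
    -- Compare with the perturbation of F' to the nearby weights and pass to the limit in both
    -- costs.
    · intro F' hF'
      have h1 := M.tendsto_flowCost hFt hgc hc₀
      have h2 := M.tendsto_flowCost
        (((M.continuous_adjustFlow x₀ F').tendsto _).comp hgx) hgc hc₀
      rw [adjustFlow_self] at h2
      refine le_of_tendsto_of_tendsto h1 h2 ?_
      filter_upwards [hgd, hWd] with q hq hq'
      exact hq'.2 _ (M.isFeasible_adjustFlow hx₀ hq.1 hF')
  have hlim : M.wardropFlow x₀ c₀ = M.totalFlow F :=
    (M.isWardrop_wardrop hx₀ fun e => (hc₀ e).le).totalFlow_eq M hc₀ hFW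
  simp only [hlim]
  exact tendsto_pi_nhds.2 fun e => ((M.continuous_totalFlow e).tendsto _).comp hFt

end Flows

end TrafficModel

namespace TrafficModel

/-! ### Capacity bounds, monotonicity of the cost, homogeneity and termination of the cascade -/

section Cascade

open scoped Classical

variable {V : Type*} [Fintype V] (M : TrafficModel V)

lemma sum_nonneg_of_nonneg {x : V → ℝ} (hx : 0 ≤ x) : 0 ≤ ∑ v, x v :=
  Finset.sum_nonneg fun v _ => hx v

lemma sum_pos_of_ne_zero {x : V → ℝ} (hx : 0 ≤ x) (hx0 : x ≠ 0) : 0 < ∑ v, x v := by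
  obtain ⟨v, hv⟩ := Function.ne_iff.1 hx0
  exact Finset.sum_pos' (fun v _ => hx v) ⟨v, Finset.mem_univ v, lt_of_le_of_ne (hx v) hv.symm⟩

lemma εmin_mul_le_capacity₀ (x : V → ℝ) (e : M.Edge) : M.εmin * ∑ v, x v ≤ M.capacity₀ x e :=
  le_max_left _ _

lemma capacity₀_nonneg {x : V → ℝ} (hx : 0 ≤ x) (e : M.Edge) : 0 ≤ M.capacity₀ x e :=
  (mul_nonneg M.εmin_pos.le (sum_nonneg_of_nonneg hx)).trans (M.εmin_mul_le_capacity₀ x e)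

lemma capacity₀_pos {x : V → ℝ} (hx : 0 ≤ x) (hx0 : x ≠ 0) (e : M.Edge) : 0 < M.capacity₀ x e :=
  (mul_pos M.εmin_pos (sum_pos_of_ne_zero hx hx0)).trans_le (M.εmin_mul_le_capacity₀ x e)

lemma totalFlow_shortestFlow_smul (t : ℝ) (x : V → ℝ) (e : M.Edge) :
    M.totalFlow (M.shortestFlow (t • x)) e = t * M.totalFlow (M.shortestFlow x) e := by
  simp only [totalFlow, shortestFlow, Finset.mul_sum, Pi.smul_apply, smul_eq_mul]
  refine Finset.sum_congr rfl fun k _ => Finset.sum_congr rfl fun w _ => ?_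
  ring

lemma capacity₀_smul {t : ℝ} (ht : 0 ≤ t) (x : V → ℝ) :
    M.capacity₀ (t • x) = t • M.capacity₀ x := by
  ext e
  simp only [capacity₀, totalFlow_shortestFlow_smul, Pi.smul_apply, smul_eq_mul,
    mul_max_of_nonneg _ _ ht, ← Finset.mul_sum, mul_left_comm _ t]

lemma continuous_capacity₀ (e : M.Edge) : Continuous fun x => M.capacity₀ x e := by
  unfold capacity₀ totalFlow shortestFlow
  fun_prop

/-- The cost of the Wardrop equilibrium for the weights `x` and capacities `c`. -/
noncomputable def equilibriumCost (x : V → ℝ) (c : M.Edge → ℝ) : ℝ :=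
  ∑ e, M.edgeCost e (M.wardropFlow x c e) (c e)

lemma exceedance_eq (x : V → ℝ) (s : M.Stage) (e : M.Edge) :
    M.exceedance x s e = M.wardropFlow x s.capacity e / s.capacity e := rfl

lemma wardropFlow_nonneg {x : V → ℝ} (hx : 0 ≤ x) {c : M.Edge → ℝ} (hc : ∀ e, 0 ≤ c e)
    (e : M.Edge) : 0 ≤ M.wardropFlow x c e :=
  M.totalFlow_nonneg (M.isWardrop_wardrop hx hc).1.1 e

lemma exceedance_nonneg {x : V → ℝ} (hx : 0 ≤ x) {s : M.Stage} (hs : ∀ e, 0 ≤ s.capacity e)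
    (e : M.Edge) : 0 ≤ M.exceedance x s e :=
  div_nonneg (M.wardropFlow_nonneg hx hs e) (hs e)

lemma equilibriumCost_le {x : V → ℝ} (hx : 0 ≤ x) {c : M.Edge → ℝ} (hc : ∀ e, 0 ≤ c e)
    {F : Matrix M.Edge V ℝ} (hF : M.IsFeasible (M.netTravel x) F) :
    M.equilibriumCost x c ≤ M.flowCost F c :=
  (M.isWardrop_wardrop hx hc).2 F hF

lemma equilibriumCost_nonneg {x : V → ℝ} (hx : 0 ≤ x) {c : M.Edge → ℝ} (hc : ∀ e, 0 ≤ c e) :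
    0 ≤ M.equilibriumCost x c :=
  Finset.sum_nonneg fun e _ => M.edgeCost_nonneg e (M.wardropFlow_nonneg hx hc e) (hc e)

/-- The equilibrium for the smaller capacities remains feasible for the larger ones and costs no
more there. -/
lemma equilibriumCost_antitone {x : V → ℝ} (hx : 0 ≤ x) {c c' : M.Edge → ℝ}
    (hc : ∀ e, 0 < c e) (hcc : ∀ e, c e ≤ c' e) :
    M.equilibriumCost x c' ≤ M.equilibriumCost x c := by
  have h := M.isWardrop_wardrop hx fun e => (hc e).le
  exact (M.equilibriumCost_le hx (fun e => (hc e).le.trans (hcc e)) h.1).trans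
    (M.flowCost_antitone h.1.1 hc hcc)

/-- With equality, the equilibrium for `c` would also be optimal for `c'`. Uniqueness of total flows
then puts positive flow on `e₀`, and evaluating this flow at `c'` instead of `c` saves a positive
amount. -/
lemma equilibriumCost_lt {x : V → ℝ} (hx : 0 ≤ x) {c c' : M.Edge → ℝ}
    (hc : ∀ e, 0 < c e) (hcc : ∀ e, c e ≤ c' e) {e₀ : M.Edge} (he₀ : c e₀ < c' e₀)
    (hf : 0 < M.wardropFlow x c' e₀) :
    M.equilibriumCost x c' < M.equilibriumCost x c := by
  have hc' : ∀ e, 0 < c' e := fun e => (hc e).trans_le (hcc e)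
  have h := M.isWardrop_wardrop hx fun e => (hc e).le
  have h' := M.isWardrop_wardrop hx fun e => (hc' e).le
  have hle := M.flowCost_antitone h.1.1 hc hcc
  by_contra hcon
  push Not at hcon
  have hW : M.IsWardrop (M.netTravel x) c' (M.wardrop (M.netTravel x) c) :=
    ⟨h.1, fun F hF => (hle.trans hcon).trans (h'.2 F hF)⟩
  have heq : M.wardropFlow x c = M.wardropFlow x c' := hW.totalFlow_eq M hc' h'
  have hlt : M.flowCost (M.wardrop (M.netTravel x) c) c' <
      M.flowCost (M.wardrop (M.netTravel x) c) c := by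
    refine Finset.sum_lt_sum
      (fun e _ => M.edgeCost_antitone e (M.totalFlow_nonneg h.1.1 e) (hc e) (hcc e))
      ⟨e₀, Finset.mem_univ _, M.edgeCost_strictAnti e₀ ?_ (hc e₀) he₀⟩
    exact lt_of_lt_of_eq hf (congrFun heq e₀).symm
  exact absurd (h'.2 _ h.1) (not_le.2 (hlt.trans_le hcon))

lemma equilibriumCost_smul {x : V → ℝ} (hx : 0 ≤ x) {c : M.Edge → ℝ} (hc : ∀ e, 0 < c e) {t : ℝ}
    (ht : 0 < t) : M.equilibriumCost (t • x) (t • c) = t * M.equilibriumCost x c := by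
  simp only [equilibriumCost, M.wardropFlow_smul hx hc ht, Pi.smul_apply, smul_eq_mul,
    M.edgeCost_mul _ ht.ne', Finset.mul_sum]

lemma equilibriumCost_zero {c : M.Edge → ℝ} (hc : ∀ e, 0 ≤ c e) :
    M.equilibriumCost 0 c = 0 := by
  refine le_antisymm ?_ (M.equilibriumCost_nonneg le_rfl hc)
  refine (M.equilibriumCost_le le_rfl hc (M.isFeasible_walkFlow le_rfl)).trans_eq ?_
  simp [flowCost_eq_sum_edgeCost, totalFlow, walkFlow, edgeCost_zero]

lemma continuousOn_equilibriumCost :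
    ContinuousOn (fun q : (V → ℝ) × (M.Edge → ℝ) => M.equilibriumCost q.1 q.2)
      {q | 0 ≤ q.1 ∧ ∀ e, 0 < q.2 e} := by
  unfold equilibriumCost
  refine continuousOn_finsetSum _ fun e _ q hq => ?_
  have h1 := (continuousWithinAt_pi.1 (M.continuousOn_wardropFlow q hq) e).tendsto
  have h2 : Tendsto (fun q : (V → ℝ) × (M.Edge → ℝ) => q.2 e)
      (𝓝[{q | 0 ≤ q.1 ∧ ∀ e, 0 < q.2 e}] q) (𝓝 (q.2 e)) :=
    ((continuous_apply e).comp continuous_snd).continuousWithinAt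
  have h3 := M.continuousAt_edgeCost e (q := (M.wardropFlow q.1 q.2 e, q.2 e)) (hq.2 e)
  exact h3.tendsto.comp (h1.prodMk_nhds h2)

/-- Compare with `walkFlow` at the smallest admissible capacity; after dividing by the total weight,
the bound no longer depends on the weights. -/
lemma exists_equilibriumCost_le {κ : ℝ} (hκ : 0 < κ) :
    ∃ C, 0 ≤ C ∧ ∀ (x : V → ℝ) (c : M.Edge → ℝ), 0 ≤ x → x ≠ 0 → (∀ e, κ * ∑ v, x v ≤ c e) →
      M.equilibriumCost x c ≤ C * ∑ v, x v := by
  refine ⟨∑ e, M.edgeCost e (∑ k, M.unitFlow e k) κ, Finset.sum_nonneg fun e _ =>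
    M.edgeCost_nonneg e (Finset.sum_nonneg fun k _ => M.unitFlow_nonneg e k) hκ.le,
    fun x c hx hx0 hc => ?_⟩
  have hs := sum_pos_of_ne_zero hx hx0
  have hκs := mul_pos hκ hs
  refine (M.equilibriumCost_le hx (fun e => hκs.le.trans (hc e))
    (M.isFeasible_walkFlow hx)).trans ?_
  refine (M.flowCost_antitone (M.isFeasible_walkFlow hx).1 (c := fun _ => κ * ∑ v, x v)
    (fun _ => hκs) hc).trans ?_
  rw [flowCost_eq_sum_edgeCost, Finset.sum_mul]
  refine Finset.sum_le_sum fun e _ => ?_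
  rw [mul_comm (M.edgeCost _ _ _), ← M.edgeCost_mul e hs.ne', mul_comm κ]
  refine M.edgeCost_mono e (M.totalFlow_nonneg (M.isFeasible_walkFlow hx).1 e) ?_ (by positivity)
  rw [Finset.mul_sum]
  refine Finset.sum_le_sum fun k _ => ?_
  exact mul_le_mul_of_nonneg_right
    (Finset.single_le_sum (f := x) (fun v _ => hx v) (Finset.mem_univ k)) (M.unitFlow_nonneg e k)

lemma cascade_add_two (x : V → ℝ) (u : ℝ) (e₁ : M.Edge) (ξ : ℕ × M.Edge → ℝ) (r : ℕ) :
    M.cascade x u e₁ ξ (r + 2) = M.nextStage x (r + 2) (M.cascade x u e₁ ξ (r + 1))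
      (M.newDisrupted x (fun e => ξ (r + 2, e)) (r + 2) (M.cascade x u e₁ ξ (r + 1))) := rfl

lemma lM_le_one : M.lM ≤ 1 := M.lM_lt_one.le

lemma lm_le_one : M.lm ≤ 1 := M.lm_le_lM.trans M.lM_le_one

lemma nextStage_capacity_bounds {x : V → ℝ} (hx : 0 ≤ x) (r : ℕ) {s : M.Stage}
    (hs : ∀ e, 0 ≤ s.capacity e) (D : Set M.Edge) (e : M.Edge) :
    M.lm * s.capacity e ≤ (M.nextStage x r s D).capacity e ∧
      (M.nextStage x r s D).capacity e ≤ s.capacity e := by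
  have h1 := M.φ_mem r e _ (M.exceedance_nonneg hx hs e)
  have h2 := M.lm_le_one
  have h3 := M.lM_le_one
  have h4 := hs e
  simp only [nextStage]
  split_ifs
  · exact ⟨mul_le_mul_of_nonneg_right h1.1 h4, mul_le_of_le_one_left h4 (h1.2.trans h3)⟩
  · exact ⟨mul_le_of_le_one_left h4 h2, le_rfl⟩

variable {x : V → ℝ} {u : ℝ} {e₁ : M.Edge} {ξ : ℕ × M.Edge → ℝ}

/-- Nonnegativity is carried along in the induction because the bounds on the reduction factors are
assumed for nonnegative exceedances only. -/
lemma cascade_capacity_succ_bounds (hx : 0 ≤ x) (hu : u ∈ Set.Icc M.lm M.lM) : ∀ (r : ℕ),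
    (∀ e, 0 ≤ (M.cascade x u e₁ ξ r).capacity e) ∧ ∀ (e : M.Edge),
    M.lm * (M.cascade x u e₁ ξ r).capacity e ≤ (M.cascade x u e₁ ξ (r + 1)).capacity e ∧
      (M.cascade x u e₁ ξ (r + 1)).capacity e ≤ (M.cascade x u e₁ ξ r).capacity e
  | 0 => by
    refine ⟨M.capacity₀_nonneg hx, fun e => ?_⟩
    have h2 := M.lm_le_one
    have h3 := M.lM_le_one
    have h4 := M.capacity₀_nonneg hx e
    simp only [cascade]
    split_ifs
    · exact ⟨mul_le_mul_of_nonneg_right hu.1 h4, mul_le_of_le_one_left h4 (hu.2.trans h3)⟩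
    · exact ⟨mul_le_of_le_one_left h4 h2, le_rfl⟩
  | r + 1 => by
    have h := cascade_capacity_succ_bounds hx hu r
    have h0 : ∀ e, 0 ≤ (M.cascade x u e₁ ξ (r + 1)).capacity e := fun e =>
      (mul_nonneg M.lm_pos.le (h.1 e)).trans (h.2 e).1
    exact ⟨h0, fun e => M.nextStage_capacity_bounds hx _ h0 _ e⟩

lemma cascade_capacity_nonneg (hx : 0 ≤ x) (hu : u ∈ Set.Icc M.lm M.lM) (r : ℕ) (e : M.Edge) :
    0 ≤ (M.cascade x u e₁ ξ r).capacity e :=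
  (M.cascade_capacity_succ_bounds hx hu r).1 e

lemma cascade_capacity_antitone (hx : 0 ≤ x) (hu : u ∈ Set.Icc M.lm M.lM) {r s : ℕ} (hrs : r ≤ s)
    (e : M.Edge) : (M.cascade x u e₁ ξ s).capacity e ≤ (M.cascade x u e₁ ξ r).capacity e :=
  antitone_nat_of_succ_le (f := fun r => (M.cascade x u e₁ ξ r).capacity e)
    (fun r => ((M.cascade_capacity_succ_bounds hx hu r).2 e).2) hrs

lemma pow_mul_le_cascade_capacity (hx : 0 ≤ x) (hu : u ∈ Set.Icc M.lm M.lM) (r : ℕ)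
    (e : M.Edge) : M.lm ^ r * M.capacity₀ x e ≤ (M.cascade x u e₁ ξ r).capacity e := by
  induction r with
  | zero => simp [cascade]
  | succ r ih =>
    refine le_trans ?_ ((M.cascade_capacity_succ_bounds hx hu r).2 e).1
    rw [pow_succ', mul_assoc]
    exact mul_le_mul_of_nonneg_left ih M.lm_pos.le

lemma cascade_capacity_pos (hx : 0 ≤ x) (hx0 : x ≠ 0) (hu : u ∈ Set.Icc M.lm M.lM) (r : ℕ)
    (e : M.Edge) : 0 < (M.cascade x u e₁ ξ r).capacity e :=
  (mul_pos (pow_pos M.lm_pos r) (M.capacity₀_pos hx hx0 e)).trans_le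
    (M.pow_mul_le_cascade_capacity hx hu r e)

/-! ### Homogeneity -/

/-- The state with all capacities multiplied by `t`. -/
noncomputable def Stage.scale {M : TrafficModel V} (t : ℝ) (s : M.Stage) : M.Stage where
  capacity := t • s.capacity
  count := s.count
  disrupted := s.disrupted

lemma exceedance_scale {t : ℝ} (ht : 0 < t) (hx : 0 ≤ x) {s : M.Stage}
    (hs : ∀ e, 0 < s.capacity e) (e : M.Edge) :
    M.exceedance (t • x) (s.scale t) e = M.exceedance x s e := by
  simp only [exceedance_eq, Stage.scale, M.wardropFlow_smul hx hs ht, Pi.smul_apply, smul_eq_mul]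
  exact mul_div_mul_left _ _ ht.ne'

lemma newDisrupted_scale {t : ℝ} (ht : 0 < t) (hx : 0 ≤ x) {s : M.Stage}
    (hs : ∀ e, 0 < s.capacity e) (ζ : M.Edge → ℝ) (r : ℕ) :
    M.newDisrupted (t • x) ζ r (s.scale t) = M.newDisrupted x ζ r s := by
  simp only [newDisrupted, M.exceedance_scale ht hx hs]
  rfl

lemma nextStage_scale {t : ℝ} (ht : 0 < t) (hx : 0 ≤ x) {s : M.Stage}
    (hs : ∀ e, 0 < s.capacity e) (r : ℕ) (D : Set M.Edge) :
    M.nextStage (t • x) r (s.scale t) D = (M.nextStage x r s D).scale t := by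
  simp only [nextStage, M.exceedance_scale ht hx hs]
  simp only [Stage.scale, Stage.mk.injEq, and_true]
  ext e
  simp only [Pi.smul_apply, smul_eq_mul]
  split_ifs <;> ring

/-- Exceedances are quotients of quantities of degree one, so the same edges are disrupted by the
same factors. Positive capacities, hence nonzero weights, are needed for the uniqueness behind
`wardropFlow_smul`. -/
lemma cascade_smul {t : ℝ} (ht : 0 < t) (hx : 0 ≤ x) (hx0 : x ≠ 0) (hu : u ∈ Set.Icc M.lm M.lM) :
    ∀ r, M.cascade (t • x) u e₁ ξ r = (M.cascade x u e₁ ξ r).scale t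
  | 0 => by simp [cascade, Stage.scale, M.capacity₀_smul ht.le]
  | 1 => by
    simp only [cascade, Stage.scale, M.capacity₀_smul ht.le, Stage.mk.injEq, and_self, and_true]
    ext e
    simp only [Pi.smul_apply, smul_eq_mul]
    split_ifs <;> ring
  | r + 2 => by
    have hs := M.cascade_capacity_pos (e₁ := e₁) (ξ := ξ) hx hx0 hu (r + 1)
    rw [cascade_add_two, cascade_add_two, cascade_smul ht hx hx0 hu (r + 1),
      M.newDisrupted_scale ht hx hs, M.nextStage_scale ht hx hs]

lemma congestionCost_eq (r : ℕ) : M.congestionCost x u e₁ ξ r =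
    M.equilibriumCost x (M.cascade x u e₁ ξ r).capacity -
      M.equilibriumCost x (M.capacity₀ x) := rfl

lemma congestionCost_smul {t : ℝ} (ht : 0 < t) (hx : 0 ≤ x) (hx0 : x ≠ 0)
    (hu : u ∈ Set.Icc M.lm M.lM) (r : ℕ) :
    M.congestionCost (t • x) u e₁ ξ r = t * M.congestionCost x u e₁ ξ r := by
  rw [congestionCost_eq, congestionCost_eq, M.cascade_smul ht hx hx0 hu, M.capacity₀_smul ht.le,
    Stage.scale, M.equilibriumCost_smul hx (M.cascade_capacity_pos hx hx0 hu _) ht,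
    M.equilibriumCost_smul hx (M.capacity₀_pos hx hx0) ht, mul_sub]

lemma congestionCost_zero (hu : u ∈ Set.Icc M.lm M.lM) (r : ℕ) :
    M.congestionCost 0 u e₁ ξ r = 0 := by
  rw [congestionCost_eq, M.equilibriumCost_zero (M.cascade_capacity_nonneg le_rfl hu r),
    M.equilibriumCost_zero (M.capacity₀_nonneg le_rfl), sub_zero]

lemma congestionCost_nonneg (hx : 0 ≤ x) (hu : u ∈ Set.Icc M.lm M.lM) (r : ℕ) :
    0 ≤ M.congestionCost x u e₁ ξ r := by
  by_cases hx0 : x = 0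
  · subst hx0
    rw [M.congestionCost_zero hu]
  · exact sub_nonneg.2 (M.equilibriumCost_antitone hx (M.cascade_capacity_pos hx hx0 hu r)
      fun e => M.cascade_capacity_antitone hx hu (Nat.zero_le r) e)

lemma exists_congestionCost_le (r : ℕ) : ∃ C, 0 < C ∧ ∀ (x : V → ℝ) (u : ℝ) (e₁ : M.Edge)
    (ξ : ℕ × M.Edge → ℝ), 0 ≤ x → u ∈ Set.Icc M.lm M.lM →
      M.congestionCost x u e₁ ξ r ≤ C * ∑ v, x v := by
  obtain ⟨C, hC, h⟩ := M.exists_equilibriumCost_le (κ := M.lm ^ r * M.εmin)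
    (mul_pos (pow_pos M.lm_pos r) M.εmin_pos)
  refine ⟨C + 1, by linarith, fun x u e₁ ξ hx hu => ?_⟩
  by_cases hx0 : x = 0
  · subst hx0
    simp [M.congestionCost_zero hu]
  · have h1 := h x (M.cascade x u e₁ ξ r).capacity hx hx0 fun e => by
      rw [mul_assoc]
      exact (mul_le_mul_of_nonneg_left (M.εmin_mul_le_capacity₀ x e)
        (pow_pos M.lm_pos r).le).trans (M.pow_mul_le_cascade_capacity hx hu r e)
    have h2 := M.equilibriumCost_nonneg hx (M.capacity₀_nonneg hx)
    have h3 := sum_nonneg_of_nonneg hx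
    rw [congestionCost_eq]
    linarith

/-- Stage 1 strictly lowers the capacity of `e₁`, later stages never restore it, and `e₁` carries
flow before the cascade. -/
lemma congestionCost_pos (hx : 0 ≤ x) (hx0 : x ≠ 0) (hu : u ∈ Set.Icc M.lm M.lM) {r : ℕ}
    (hr : 1 ≤ r) (hf : 0 < M.wardropFlow x (M.capacity₀ x) e₁) :
    0 < M.congestionCost x u e₁ ξ r := by
  refine sub_pos.2 (M.equilibriumCost_lt hx (M.cascade_capacity_pos hx hx0 hu r)
    (fun e => M.cascade_capacity_antitone hx hu (Nat.zero_le r) e) (e₀ := e₁) ?_ hf)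
  refine (M.cascade_capacity_antitone hx hu hr e₁).trans_lt ?_
  simp only [cascade, if_true]
  exact mul_lt_of_lt_one_left (M.capacity₀_pos hx hx0 e₁) (hu.2.trans_lt M.lM_lt_one)

/-- The zero flow would violate the balance equation at w for the traffic originating at v. -/
lemma exists_wardropFlow_pos {v w : V} (hvw : v ≠ w) (hQ : 0 < M.Q w v) {c : M.Edge → ℝ}
    (hc : ∀ e, 0 ≤ c e) : ∃ e, 0 < M.wardropFlow (Pi.single v 1) c e := by
  have hx : (0 : V → ℝ) ≤ Pi.single v 1 := Pi.single_nonneg.2 zero_le_one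
  by_contra! hcon
  have h := M.isWardrop_wardrop hx hc
  have h0 : ∀ e k, M.wardrop (M.netTravel (Pi.single v 1)) c e k = 0 := fun e k =>
    le_antisymm ((Finset.single_le_sum (fun k _ => h.1.1 e k) (Finset.mem_univ k)).trans (hcon e))
      (h.1.1 e k)
  have h1 := (M.isFeasible_netTravel_iff.1 h.1).2 w v
  simp only [h0, mul_zero, Finset.sum_const_zero, Pi.single_eq_same, hvw.symm, if_false] at h1
  linarith

/-! ### Termination -/

lemma cascade_count_le : ∀ (r : ℕ) (e : M.Edge), (M.cascade x u e₁ ξ r).count e ≤ M.n e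
  | 0, e => Nat.zero_le _
  | 1, e => by
    simp only [cascade]
    split_ifs
    · exact M.n_pos e
    · exact Nat.zero_le _
  | r + 2, e => by
    rw [cascade_add_two]
    simp only [nextStage]
    split_ifs with h
    · exact h.2.1
    · exact cascade_count_le (r + 1) e

/-- Every stage from 1 on that has a disruption adds at least one to the total count, and it can
only follow a stage with a disruption. -/
lemma le_sum_cascade_count : ∀ r : ℕ, (M.cascade x u e₁ ξ r).disrupted.Nonempty →
    r ≤ ∑ e, (M.cascade x u e₁ ξ r).count e
  | 0, _ => Nat.zero_le _
  | 1, _ => by simp [cascade]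
  | r + 2, h => by
    rw [cascade_add_two] at h ⊢
    obtain ⟨e, he⟩ := h
    have ih := le_sum_cascade_count (r + 1) he.1
    refine Nat.succ_le_of_lt (ih.trans_lt (Finset.sum_lt_sum (fun e' _ => ?_)
      ⟨e, Finset.mem_univ e, ?_⟩))
    · simp only [nextStage]
      split_ifs <;> omega
    · simp only [nextStage] at he ⊢
      rw [if_pos he]
      exact Nat.lt_succ_self _

lemma cascade_disrupted_eq_empty {r : ℕ} (hr : ∑ e, M.n e < r) :
    (M.cascade x u e₁ ξ r).disrupted = ∅ := by
  by_contra h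
  have h1 := M.le_sum_cascade_count r (Set.nonempty_iff_ne_empty.2 h)
  have h2 : ∑ e, (M.cascade x u e₁ ξ r).count e ≤ ∑ e, M.n e :=
    Finset.sum_le_sum fun e _ => M.cascade_count_le r e
  omega

/-- The condition `1 ≤ r` matters: stage 0 has no disruption either, yet stage 1 changes the state.
-/
lemma cascade_eq_of_disrupted_eq_empty {r : ℕ} (hr : 1 ≤ r)
    (h : (M.cascade x u e₁ ξ r).disrupted = ∅) {s : ℕ} (hs : r ≤ s) :
    M.cascade x u e₁ ξ s = M.cascade x u e₁ ξ r := by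
  induction s, hs using Nat.le_induction with
  | base => rfl
  | succ s hs ih =>
    obtain ⟨k, rfl⟩ := Nat.exists_eq_add_of_le' (hr.trans hs)
    rw [cascade_add_two, ih]
    simp only [newDisrupted, h, Set.not_nonempty_empty, false_and, Set.ofPred_false, nextStage,
      Set.mem_empty_iff_false, if_false]
    rw [← h]

/-- One deterministic stage serves for all weights and all noise, so the random terminal stage never
has to be handled. -/
lemma congestionCostEnd_eq {N : ℕ} (hN : ∑ e, M.n e < N) :
    M.congestionCostEnd x u e₁ ξ = M.congestionCost x u e₁ ξ N := by
  have hmem : N ∈ {r | 1 ≤ r ∧ (M.cascade x u e₁ ξ r).disrupted = ∅} :=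
    ⟨by omega, M.cascade_disrupted_eq_empty hN⟩
  have h := Nat.sInf_mem ⟨N, hmem⟩
  rw [congestionCostEnd, congestionCost_eq, congestionCost_eq,
    M.cascade_eq_of_disrupted_eq_empty h.1 h.2 (Nat.sInf_le hmem)]
  rfl

lemma congestionCost_eq_of_le {N s : ℕ} (hN : ∑ e, M.n e < N) (hs : N ≤ s) :
    M.congestionCost x u e₁ ξ s = M.congestionCost x u e₁ ξ N := by
  rw [← M.congestionCostEnd_eq hN, ← M.congestionCostEnd_eq (hN.trans_le hs)]

end Cascade

end TrafficModel

/-- The Wardrop flow is an arbitrary choice outside the admissible weights and capacities, so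
measurability is obtained through the subtype on which it is continuous. -/
lemma ContinuousOn.measurable_comp_of_forall_mem {α β γ : Type*} [MeasurableSpace α]
    [TopologicalSpace β] [MeasurableSpace β] [OpensMeasurableSpace β]
    [TopologicalSpace γ] [MeasurableSpace γ] [BorelSpace γ] {f : β → γ} {s : Set β}
    (hf : ContinuousOn f s) {g : α → β} (hg : Measurable g) (hgs : ∀ a, g a ∈ s) :
    Measurable fun a => f (g a) :=
  (continuousOn_iff_continuous_domRestrict.1 hf).measurable.comp (hg.subtype_mk (h := hgs))

namespace TrafficModel

/-! ### Joint measurability of the cascade in weights and noise -/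

section Measurability

open scoped Classical

variable {V : Type*} [Fintype V] (M : TrafficModel V)

instance : MeasurableSingletonClass M.Edge := ⟨fun _ => trivial⟩

variable {S : Type*} [MeasurableSpace S] {x : S → V → ℝ} {u : S → ℝ} {e₁ : S → M.Edge}
  {ξ : S → ℕ × M.Edge → ℝ}

lemma measurable_wardropFlow_comp (hx : Measurable x) (hx0 : ∀ a, 0 ≤ x a)
    {c : S → M.Edge → ℝ} (hc : ∀ e, Measurable fun a => c a e) (hc0 : ∀ a e, 0 < c a e)
    (e : M.Edge) : Measurable fun a => M.wardropFlow (x a) (c a) e := by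
  have h := M.continuousOn_wardropFlow.measurable_comp_of_forall_mem
    (hx.prodMk (measurable_pi_lambda c hc)) fun a => ⟨hx0 a, hc0 a⟩
  exact measurable_pi_iff.1 h e

lemma measurable_equilibriumCost_comp (hx : Measurable x) (hx0 : ∀ a, 0 ≤ x a)
    {c : S → M.Edge → ℝ} (hc : ∀ e, Measurable fun a => c a e) (hc0 : ∀ a e, 0 < c a e) :
    Measurable fun a => M.equilibriumCost (x a) (c a) := by
  have h := M.continuousOn_equilibriumCost.measurable_comp_of_forall_mem
    (hx.prodMk (measurable_pi_lambda c hc)) fun a => ⟨hx0 a, hc0 a⟩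
  exact h

lemma measurable_exceedance_comp (hx : Measurable x) (hx0 : ∀ a, 0 ≤ x a) {s : S → M.Stage}
    (hc : ∀ e, Measurable fun a => (s a).capacity e) (hc0 : ∀ a e, 0 < (s a).capacity e)
    (e : M.Edge) : Measurable fun a => M.exceedance (x a) (s a) e :=
  (M.measurable_wardropFlow_comp hx hx0 hc hc0 e).div (hc e)

lemma measurable_capacity₀_comp (hx : Measurable x) (e : M.Edge) :
    Measurable fun a => M.capacity₀ (x a) e :=
  (M.continuous_capacity₀ e).measurable.comp hx

/-- Counts and disrupted sets enter the next disruption rule, so all three components go through the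
induction together. -/
lemma measurable_cascade (hx : Measurable x) (hx0 : ∀ a, 0 ≤ x a) (hx1 : ∀ a, x a ≠ 0)
    (hu : Measurable u) (hu0 : ∀ a, u a ∈ Set.Icc M.lm M.lM) (he₁ : Measurable e₁)
    (hξ : Measurable ξ) : ∀ r : ℕ,
    (∀ e, Measurable fun a => (M.cascade (x a) (u a) (e₁ a) (ξ a) r).capacity e) ∧
    (∀ e, Measurable fun a => (M.cascade (x a) (u a) (e₁ a) (ξ a) r).count e) ∧
    ∀ e, MeasurableSet {a | e ∈ (M.cascade (x a) (u a) (e₁ a) (ξ a) r).disrupted}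
  | 0 => ⟨M.measurable_capacity₀_comp hx, fun _ => measurable_const, fun e => by simp [cascade]⟩
  | 1 => by
    have hs : ∀ e, MeasurableSet {a | e = e₁ a} := fun e => by
      have h : {a | e = e₁ a} = e₁ ⁻¹' {e} := Set.ext fun a => eq_comm
      exact h ▸ he₁ (measurableSet_singleton e)
    have h := M.measurable_capacity₀_comp hx
    refine ⟨fun e => Measurable.ite (hs e) (hu.mul (h e)) (h e), fun e => ?_, hs⟩
    exact Measurable.ite (hs e) measurable_const measurable_const
  | r + 2 => by
    obtain ⟨h1, h2, h3⟩ := measurable_cascade hx hx0 hx1 hu hu0 he₁ hξ (r + 1)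
    have hpos : ∀ a e, 0 < (M.cascade (x a) (u a) (e₁ a) (ξ a) (r + 1)).capacity e := fun a =>
      M.cascade_capacity_pos (hx0 a) (hx1 a) (hu0 a) (r + 1)
    have hψ := fun e => M.measurable_exceedance_comp hx hx0 h1 hpos e
    have hψ0 : ∀ e a, M.exceedance (x a) (M.cascade (x a) (u a) (e₁ a) (ξ a) (r + 1)) e ∈
        Set.Ici (0 : ℝ) := fun e a => M.exceedance_nonneg (hx0 a) (fun e => (hpos a e).le) e
    have hD : ∀ e, MeasurableSet
        {a | e ∈ (M.cascade (x a) (u a) (e₁ a) (ξ a) (r + 2)).disrupted} := fun e => by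
      have hne : MeasurableSet
          {a | (M.cascade (x a) (u a) (e₁ a) (ξ a) (r + 1)).disrupted.Nonempty} := by
        simp only [Set.Nonempty, Set.ofPred_exists]
        exact MeasurableSet.iUnion h3
      have hp := (M.p_cont (r + 2) e).measurable_comp_of_forall_mem (hψ e) (hψ0 e)
      have hξe : Measurable fun a => ξ a (r + 2, e) := (measurable_pi_apply _).comp hξ
      exact hne.inter ((measurableSet_lt (h2 e) measurable_const).inter
        ((measurableSet_lt measurable_const (hψ e)).inter (measurableSet_lt hξe hp)))
    refine ⟨fun e => ?_, fun e => ?_, hD⟩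
    · exact Measurable.ite (hD e)
        (((M.φ_cont (r + 2) e).measurable_comp_of_forall_mem (hψ e) (hψ0 e)).mul (h1 e)) (h1 e)
    · exact Measurable.ite (hD e) ((h2 e).add_const 1) (h2 e)

lemma measurable_congestionCost_comp (hx : Measurable x) (hx0 : ∀ a, 0 ≤ x a)
    (hx1 : ∀ a, x a ≠ 0) (hu : Measurable u) (hu0 : ∀ a, u a ∈ Set.Icc M.lm M.lM)
    (he₁ : Measurable e₁) (hξ : Measurable ξ) (r : ℕ) :
    Measurable fun a => M.congestionCost (x a) (u a) (e₁ a) (ξ a) r :=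
  (M.measurable_equilibriumCost_comp hx hx0 (M.measurable_cascade hx hx0 hx1 hu hu0 he₁ hξ r).1
    fun a => M.cascade_capacity_pos (hx0 a) (hx1 a) (hu0 a) r).sub
  (M.measurable_equilibriumCost_comp hx hx0 (M.measurable_capacity₀_comp hx)
    fun a => M.capacity₀_pos (hx0 a) (hx1 a))

end Measurability

/-! ### Continuity of the cascade in the weights for regular marks -/

section Continuity

open scoped Classical

variable {V : Type*} [Fintype V] (M : TrafficModel V)

lemma tendsto_wardropFlow {ι : Type*} {l : Filter ι} {x : ι → V → ℝ} {c : ι → M.Edge → ℝ}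
    {x₀ : V → ℝ} {c₀ : M.Edge → ℝ} (hx₀ : 0 ≤ x₀) (hc₀ : ∀ e, 0 < c₀ e)
    (hx : ∀ᶠ i in l, 0 ≤ x i) (hc : ∀ᶠ i in l, ∀ e, 0 < c i e)
    (hxt : Tendsto x l (𝓝 x₀)) (hct : Tendsto c l (𝓝 c₀)) :
    Tendsto (fun i => M.wardropFlow (x i) (c i)) l (𝓝 (M.wardropFlow x₀ c₀)) := by
  have h1 := (M.continuousOn_wardropFlow (x₀, c₀) ⟨hx₀, hc₀⟩).tendsto
  have h2 := h1.comp (tendsto_nhdsWithin_iff.2 ⟨hxt.prodMk_nhds hct, hx.and hc⟩)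
  exact h2

lemma tendsto_equilibriumCost {ι : Type*} {l : Filter ι} {x : ι → V → ℝ} {c : ι → M.Edge → ℝ}
    {x₀ : V → ℝ} {c₀ : M.Edge → ℝ} (hx₀ : 0 ≤ x₀) (hc₀ : ∀ e, 0 < c₀ e)
    (hx : ∀ᶠ i in l, 0 ≤ x i) (hc : ∀ᶠ i in l, ∀ e, 0 < c i e)
    (hxt : Tendsto x l (𝓝 x₀)) (hct : Tendsto c l (𝓝 c₀)) :
    Tendsto (fun i => M.equilibriumCost (x i) (c i)) l (𝓝 (M.equilibriumCost x₀ c₀)) := by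
  have h1 := (M.continuousOn_equilibriumCost (x₀, c₀) ⟨hx₀, hc₀⟩).tendsto
  have h2 := h1.comp (tendsto_nhdsWithin_iff.2 ⟨hxt.prodMk_nhds hct, hx.and hc⟩)
  exact h2

/-- The marks avoid all disruption probabilities, so that the disrupted sets are locally constant
in the weights. -/
def IsRegularMark (x : V → ℝ) (u : ℝ) (e₁ : M.Edge) (ξ : ℕ × M.Edge → ℝ) : Prop :=
  (∀ i, 0 ≤ ξ i) ∧ ∀ r e, ξ (r + 2, e) ≠
    M.p (r + 2) e (M.exceedance x (M.cascade x u e₁ ξ (r + 1)) e)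

variable {x₀ : V → ℝ} {u : ℝ} {e₁ : M.Edge} {ξ : ℕ × M.Edge → ℝ}

/-- The discrete part of the state is eventually constant near `x₀`; given this, the capacities are
built from continuous functions of the weights. -/
lemma tendsto_cascade (hx₀ : 0 ≤ x₀) (hx₁ : x₀ ≠ 0) (hu : u ∈ Set.Icc M.lm M.lM)
    (hξ : M.IsRegularMark x₀ u e₁ ξ) : ∀ r : ℕ,
    (∀ e, Tendsto (fun x => (M.cascade x u e₁ ξ r).capacity e) (𝓝[Set.Ici 0] x₀)
      (𝓝 ((M.cascade x₀ u e₁ ξ r).capacity e))) ∧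
    (∀ᶠ x in 𝓝[Set.Ici 0] x₀, (M.cascade x u e₁ ξ r).count = (M.cascade x₀ u e₁ ξ r).count ∧
      (M.cascade x u e₁ ξ r).disrupted = (M.cascade x₀ u e₁ ξ r).disrupted)
  | 0 => ⟨fun e => ((M.continuous_capacity₀ e).tendsto x₀).mono_left nhdsWithin_le_nhds,
      Eventually.of_forall fun _ => ⟨rfl, rfl⟩⟩
  | 1 => by
    refine ⟨fun e => ?_, Eventually.of_forall fun _ => ⟨rfl, rfl⟩⟩
    have h : Tendsto (fun x => M.capacity₀ x e) (𝓝[Set.Ici 0] x₀) (𝓝 (M.capacity₀ x₀ e)) :=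
      ((M.continuous_capacity₀ e).tendsto x₀).mono_left nhdsWithin_le_nhds
    simp only [cascade]
    split_ifs
    · exact h.const_mul u
    · exact h
  | r + 2 => by
    obtain ⟨h1, h2⟩ := tendsto_cascade hx₀ hx₁ hu hξ (r + 1)
    set s₀ := M.cascade x₀ u e₁ ξ (r + 1) with hs₀
    have hpos := M.cascade_capacity_pos (e₁ := e₁) (ξ := ξ) hx₀ hx₁ hu (r + 1)
    have hx : ∀ᶠ x in 𝓝[Set.Ici 0] x₀, 0 ≤ x ∧ x ≠ 0 :=
      eventually_mem_nhdsWithin.and (eventually_nhdsWithin_of_eventually_nhds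
        (isOpen_ne.eventually_mem hx₁))
    have hflow : Tendsto (fun x => M.wardropFlow x (M.cascade x u e₁ ξ (r + 1)).capacity)
        (𝓝[Set.Ici 0] x₀) (𝓝 (M.wardropFlow x₀ s₀.capacity)) := by
      exact M.tendsto_wardropFlow hx₀ hpos (hx.mono fun x h => h.1)
        (hx.mono fun x h => M.cascade_capacity_pos h.1 h.2 hu (r + 1))
        (tendsto_id.mono_left nhdsWithin_le_nhds) (tendsto_pi_nhds.2 h1)
    have hψ : ∀ e, Tendsto (fun x => M.exceedance x (M.cascade x u e₁ ξ (r + 1)) e)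
        (𝓝[Set.Ici 0] x₀) (𝓝[Set.Ici 0] (M.exceedance x₀ s₀ e)) := fun e => by
      refine tendsto_nhdsWithin_iff.2
        ⟨(tendsto_pi_nhds.1 hflow e).div (h1 e) (hpos e).ne', ?_⟩
      filter_upwards [hx] with x hx'
      exact M.exceedance_nonneg hx'.1 (fun e => (M.cascade_capacity_pos hx'.1 hx'.2 hu _ e).le) e
    have hψ0 : ∀ e, M.exceedance x₀ s₀ e ∈ Set.Ici (0 : ℝ) := fun e =>
      M.exceedance_nonneg hx₀ (fun e => (hpos e).le) e
    have hp : ∀ e, Tendsto (fun x => M.p (r + 2) e (M.exceedance x (M.cascade x u e₁ ξ (r + 1)) e))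
        (𝓝[Set.Ici 0] x₀) (𝓝 (M.p (r + 2) e (M.exceedance x₀ s₀ e))) := fun e =>
      (M.p_cont (r + 2) e _ (hψ0 e)).tendsto.comp (hψ e)
    have hcond : ∀ e, ∀ᶠ x in 𝓝[Set.Ici 0] x₀,
        ((1 < M.exceedance x (M.cascade x u e₁ ξ (r + 1)) e ∧
          ξ (r + 2, e) < M.p (r + 2) e (M.exceedance x (M.cascade x u e₁ ξ (r + 1)) e)) ↔
        (1 < M.exceedance x₀ s₀ e ∧ ξ (r + 2, e) < M.p (r + 2) e (M.exceedance x₀ s₀ e))) := by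
      intro e
      rcases lt_or_gt_of_ne (hξ.2 r e) with h | h
      -- Here the mark is below the disruption probability. Since p is monotone with p(1) = 0 and
      -- marks are nonnegative, the exceedance is strictly above 1, so both strict inequalities
      -- persist nearby.
      · have h' : 1 < M.exceedance x₀ s₀ e := by
          by_contra hcon
          have := M.p_mono (r + 2) e (hψ0 e) (Set.mem_Ici.2 zero_le_one) (not_lt.1 hcon)
          rw [M.p_one] at this
          exact absurd (h.trans_le this) (not_lt.2 (hξ.1 _))
        filter_upwards [(hp e).eventually_const_lt h,
          ((hψ e).mono_right nhdsWithin_le_nhds).eventually_const_lt h'] with x hx1 hx2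
        exact iff_of_true ⟨hx2, hx1⟩ ⟨h', h⟩
      · filter_upwards [(hp e).eventually_lt_const h] with x hx1
        exact iff_of_false (fun hc => hx1.not_gt hc.2) (fun hc => hc.2.not_gt h)
    have hD : ∀ᶠ x in 𝓝[Set.Ici 0] x₀,
        M.newDisrupted x (fun e => ξ (r + 2, e)) (r + 2) (M.cascade x u e₁ ξ (r + 1)) =
          M.newDisrupted x₀ (fun e => ξ (r + 2, e)) (r + 2) s₀ := by
      filter_upwards [h2, eventually_all.2 hcond] with x hx1 hx2
      ext e
      simp only [newDisrupted, Set.mem_ofPred_eq, hx1.1, hx1.2, hx2 e]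
    simp only [cascade_add_two, ← hs₀]
    refine ⟨fun e => ?_, ?_⟩
    · have hφ : Tendsto
          (fun x => M.φ (r + 2) e (M.exceedance x (M.cascade x u e₁ ξ (r + 1)) e))
          (𝓝[Set.Ici 0] x₀) (𝓝 (M.φ (r + 2) e (M.exceedance x₀ s₀ e))) :=
        (M.φ_cont (r + 2) e _ (hψ0 e)).tendsto.comp (hψ e)
      by_cases he : e ∈ M.newDisrupted x₀ (fun e => ξ (r + 2, e)) (r + 2) s₀
      · simp only [nextStage, if_pos he]
        refine (hφ.mul (h1 e)).congr' ?_
        filter_upwards [hD] with x hx1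
        rw [hx1, if_pos he]
      · simp only [nextStage, if_neg he]
        refine (h1 e).congr' ?_
        filter_upwards [hD] with x hx1
        rw [hx1, if_neg he]
    · filter_upwards [hD, h2] with x hx1 hx2
      simp only [nextStage, hx1, hx2.1, and_self]

lemma continuousWithinAt_congestionCost (hx₀ : 0 ≤ x₀) (hx₁ : x₀ ≠ 0)
    (hu : u ∈ Set.Icc M.lm M.lM) (hξ : M.IsRegularMark x₀ u e₁ ξ) (r : ℕ) :
    ContinuousWithinAt (fun x => M.congestionCost x u e₁ ξ r) (Set.Ici 0) x₀ := by
  have hx : ∀ᶠ x in 𝓝[Set.Ici 0] x₀, 0 ≤ x ∧ x ≠ 0 :=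
    eventually_mem_nhdsWithin.and (eventually_nhdsWithin_of_eventually_nhds
      (isOpen_ne.eventually_mem hx₁))
  have key : ∀ r, Tendsto (fun x => M.equilibriumCost x (M.cascade x u e₁ ξ r).capacity)
      (𝓝[Set.Ici 0] x₀) (𝓝 (M.equilibriumCost x₀ (M.cascade x₀ u e₁ ξ r).capacity)) := fun r => by
    exact M.tendsto_equilibriumCost hx₀ (M.cascade_capacity_pos hx₀ hx₁ hu r)
      (hx.mono fun x h => h.1) (hx.mono fun x h => M.cascade_capacity_pos h.1 h.2 hu r)
      (tendsto_id.mono_left nhdsWithin_le_nhds)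
      (tendsto_pi_nhds.2 (M.tendsto_cascade hx₀ hx₁ hu hξ r).1)
  exact (key r).sub (key 0)

/-- The marks act only through the set of disrupted edges, which has finitely many values per stage.
-/
lemma finite_range_cascade (x : V → ℝ) (u : ℝ) (e₁ : M.Edge) :
    ∀ r : ℕ, (Set.range fun ξ => M.cascade x u e₁ ξ r).Finite
  | 0 => (Set.finite_singleton _).subset (Set.range_subset_iff.2 fun _ => rfl)
  | 1 => (Set.finite_singleton _).subset (Set.range_subset_iff.2 fun _ => rfl)
  | r + 2 => by
    refine ((finite_range_cascade x u e₁ (r + 1)).image2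
      (fun s D => M.nextStage x (r + 2) s D) (Set.toFinite (Set.univ : Set (Set M.Edge)))).subset ?_
    rintro _ ⟨ξ, rfl⟩
    exact ⟨_, ⟨ξ, rfl⟩, _, Set.mem_univ _, rfl⟩

end Continuity

end TrafficModel

/-! ### Power tails expressed as limits of y^α times the tail -/

section RegularVariation

variable {α K : ℝ}

lemma tendsto_rpow_mul_of_isEquivalent {f : ℝ → ℝ} (hK : K ≠ 0)
    (hf : f ~[atTop] fun x => K * x ^ (-α)) :
    Tendsto (fun y => y ^ α * f y) atTop (𝓝 K) := by
  rw [← isEquivalent_const_iff_tendsto hK]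
  refine ((IsEquivalent.refl (u := fun y : ℝ => y ^ α)).mul hf).congr_right ?_
  filter_upwards [eventually_gt_atTop 0] with y hy
  simp only [Pi.mul_apply, Real.rpow_neg hy.le]
  have := (Real.rpow_pos_of_pos hy α).ne'
  rw [Function.const_apply]
  field_simp

lemma isEquivalent_of_tendsto_rpow_mul {f : ℝ → ℝ} (hK : K ≠ 0)
    (hf : Tendsto (fun y => y ^ α * f y) atTop (𝓝 K)) :
    f ~[atTop] fun x => K * x ^ (-α) := by
  rw [← isEquivalent_const_iff_tendsto hK] at hf
  refine (hf.mul (IsEquivalent.refl (u := fun y : ℝ => y ^ (-α)))).congr_left ?_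
  filter_upwards [eventually_gt_atTop 0] with y hy
  simp only [Pi.mul_apply, Real.rpow_neg hy.le]
  have := (Real.rpow_pos_of_pos hy α).ne'
  field_simp

lemma tendsto_rpow_mul_comp_mul {T : ℝ → ℝ} (hT : Tendsto (fun y => y ^ α * T y) atTop (𝓝 K))
    {a : ℝ} (ha : 0 < a) : Tendsto (fun y => y ^ α * T (a * y)) atTop (𝓝 (a ^ (-α) * K)) := by
  have h := (hT.comp (tendsto_id.const_mul_atTop ha)).const_mul (a ^ (-α))
  refine h.congr' ?_
  filter_upwards [eventually_gt_atTop 0] with y hy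
  simp only [Function.comp_apply, id_eq, Real.mul_rpow ha.le hy.le, Real.rpow_neg ha.le]
  have := (Real.rpow_pos_of_pos ha α).ne'
  field_simp

lemma tendsto_zero_of_tendsto_rpow_mul {T : ℝ → ℝ} (hα : 0 < α)
    (hT : Tendsto (fun y => y ^ α * T y) atTop (𝓝 K)) : Tendsto T atTop (𝓝 0) := by
  have h := (tendsto_rpow_neg_atTop hα).mul hT
  rw [zero_mul] at h
  refine h.congr' ?_
  filter_upwards [eventually_gt_atTop 0] with y hy
  rw [Real.rpow_neg hy.le, inv_mul_cancel_left₀ (Real.rpow_pos_of_pos hy α).ne']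

variable {Ω : Type*} [MeasurableSpace Ω] {μ : Measure Ω}

/-- The limit form, unlike asymptotic equivalence, allows a = 0, which is needed when the cost at a
unit vector vanishes. -/
lemma tendsto_rpow_mul_tail_const_mul {X : Ω → ℝ} (hα : 0 < α)
    (hX : Tendsto (fun y => y ^ α * μ.real {ω | y < X ω}) atTop (𝓝 K)) {a : ℝ} (ha : 0 ≤ a) :
    Tendsto (fun y => y ^ α * μ.real {ω | y < a * X ω}) atTop (𝓝 (K * a ^ α)) := by
  rcases ha.eq_or_lt with rfl | ha
  · rw [Real.zero_rpow hα.ne', mul_zero]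
    refine tendsto_const_nhds.congr' ?_
    filter_upwards [eventually_ge_atTop 0] with y hy
    simp [hy.not_gt]
  · have h := tendsto_rpow_mul_comp_mul hX (inv_pos.2 ha)
    rw [Real.inv_rpow ha.le, Real.rpow_neg ha.le, inv_inv, mul_comm] at h
    refine h.congr fun y => ?_
    simp only [inv_mul_lt_iff₀ ha]

/-- By independence the joint tail is a product: one factor absorbs y^α, the other still tends to 0.
-/
lemma tendsto_rpow_mul_joint_tail {X Y : Ω → ℝ} (hα : 0 < α)
    (hX : Tendsto (fun y => y ^ α * μ.real {ω | y < X ω}) atTop (𝓝 K))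
    (hY : Tendsto (fun y => y ^ α * μ.real {ω | y < Y ω}) atTop (𝓝 K))
    (hXY : IndepFun X Y μ) {a b : ℝ} (ha : 0 < a) (hb : 0 < b) :
    Tendsto (fun y => y ^ α * μ.real {ω | a * y < X ω ∧ b * y < Y ω}) atTop (𝓝 0) := by
  have h1 := tendsto_rpow_mul_comp_mul hX ha
  have h2 := (tendsto_zero_of_tendsto_rpow_mul hα hY).comp (tendsto_id.const_mul_atTop hb)
  have h3 := h1.mul h2
  rw [mul_zero] at h3
  refine h3.congr fun y => ?_
  have h4 := hXY.measure_inter_preimage_eq_mul _ _ (measurableSet_Ioi (a := a * y))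
    (measurableSet_Ioi (a := b * y))
  have h5 : μ.real {ω | a * y < X ω ∧ b * y < Y ω} =
      μ.real {ω | a * y < X ω} * μ.real {ω | b * y < Y ω} := by
    simp only [measureReal_def, ← ENNReal.toReal_mul]
    exact congrArg ENNReal.toReal h4
  simp only [Function.comp_apply, id_eq, h5, mul_assoc]

end RegularVariation

/-! ### The single-big-jump principle for homogeneous functions -/

section BigJump

open scoped Classical

lemma measureReal_mono_of_ae {Ω : Type*} [MeasurableSpace Ω] {μ : Measure Ω} [IsFiniteMeasure μ]
    {s t : Set Ω} (h : ∀ᵐ ω ∂μ, ω ∈ s → ω ∈ t) : μ.real s ≤ μ.real t :=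
  ENNReal.toReal_mono (measure_ne_top _ _) (measure_mono_ae h)

variable {V : Type*} [Fintype V]

/-- Uniform closeness of a positively homogeneous function to its values at the unit vectors. -/
lemma exists_cone_bound {h : (V → ℝ) → ℝ}
    (hhom : ∀ t : ℝ, 0 < t → ∀ x, 0 ≤ x → h (t • x) = t * h x)
    (hcont : ∀ v, ContinuousWithinAt h (Set.Ici 0) (Pi.single v 1)) {κ : ℝ} (hκ : 0 < κ) :
    ∃ δ, 0 < δ ∧ δ ≤ 1 ∧ ∀ (v : V) (x : V → ℝ), 0 ≤ x → 0 < x v →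
      (∀ w, w ≠ v → x w ≤ δ * x v) → |h x - x v * h (Pi.single v 1)| ≤ κ * x v := by
  have h1 : ∀ v, ∃ δ, 0 < δ ∧ ∀ x : V → ℝ, 0 ≤ x → dist x (Pi.single v 1) < δ →
      dist (h x) (h (Pi.single v 1)) < κ := fun v => by
    obtain ⟨δ, hδ, hb⟩ := Metric.continuousWithinAt_iff.1 (hcont v) κ hκ
    exact ⟨δ, hδ, fun x hx hd => hb hx hd⟩
  choose δ hδ hb using h1
  obtain ⟨δ', hδ', hle⟩ : ∃ δ', 0 < δ' ∧ ∀ v, δ' < δ v := by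
    have := (eventually_all.2 fun v => eventually_nhdsWithin_of_eventually_nhds
      (s := Set.Ioi (0 : ℝ)) (eventually_lt_nhds (hδ v))).and
      (eventually_mem_nhdsWithin (a := (0 : ℝ)) (s := Set.Ioi 0))
    obtain ⟨d, hd⟩ := this.exists
    exact ⟨d, hd.2, hd.1⟩
  refine ⟨min δ' 1, lt_min hδ' one_pos, min_le_right _ _, fun v x hx hxv hw => ?_⟩
  -- By homogeneity it is enough to compare at the normalized vector, which lies close to the unit
  -- vector of v.
  set y : V → ℝ := (x v)⁻¹ • x with hy
  have hy0 : 0 ≤ y := smul_nonneg (inv_nonneg.2 hxv.le) hx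
  have hyx : x = x v • y := by rw [hy, smul_inv_smul₀ hxv.ne']
  have hdist : dist y (Pi.single v 1) < δ v := by
    refine lt_of_le_of_lt ((dist_pi_le_iff hδ'.le).2 fun w => ?_) (hle v)
    by_cases hwv : w = v
    · subst hwv
      simp [hy, hxv.ne', hδ'.le]
    · rw [Pi.single_eq_of_ne hwv, Real.dist_eq, sub_zero, abs_of_nonneg (hy0 w)]
      simp only [hy, Pi.smul_apply, smul_eq_mul]
      rw [inv_mul_le_iff₀ hxv, mul_comm]
      exact (hw w hwv).trans (mul_le_mul_of_nonneg_right (min_le_left _ _) hxv.le)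
  have h2 := hb v y hy0 hdist
  rw [Real.dist_eq] at h2
  have h3 : h x = x v * h y := by
    conv_lhs => rw [hyx]
    exact hhom _ hxv _ hy0
  rw [h3, ← mul_sub, abs_mul, abs_of_pos hxv, mul_comm]
  exact mul_le_mul_of_nonneg_right h2.le hxv.le

variable {α K : ℝ} {Ω : Type*} [MeasurableSpace Ω] {μ : Measure Ω} [IsProbabilityMeasure μ]
  {X : V → Ω → ℝ}

/-- Pigeonhole; the `+ 1` keeps the denominator positive even for empty V. -/
lemma exists_lt_of_lt_sum {x : V → ℝ} {C y : ℝ} (hC : 0 < C) (hy : 0 < y)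
    (h : y < C * ∑ v, x v) : ∃ v, (C * (Fintype.card V + 1))⁻¹ * y < x v := by
  by_contra! hcon
  have h1 : ∑ v, x v ≤ ∑ _v : V, (C * (Fintype.card V + 1))⁻¹ * y :=
    Finset.sum_le_sum fun v _ => hcon v
  rw [Finset.sum_const, Finset.card_univ, nsmul_eq_mul] at h1
  have h2 := mul_le_mul_of_nonneg_left h1 hC.le
  have h3 : C * ((Fintype.card V : ℝ) * ((C * (Fintype.card V + 1))⁻¹ * y)) =
      (Fintype.card V / (Fintype.card V + 1)) * y := by
    have : (Fintype.card V : ℝ) + 1 ≠ 0 := by positivity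
    field_simp
  have h4 : (Fintype.card V : ℝ) / (Fintype.card V + 1) ≤ 1 :=
    (div_le_one (by positivity)).2 (by linarith)
  have h5 := mul_le_mul_of_nonneg_right h4 hy.le
  linarith

/-- Single-big-jump principle for a positively homogeneous function of independent heavy-tailed
weights. -/
lemma tendsto_rpow_mul_tail_homogeneous (hα : 0 < α) (hX_meas : ∀ v, Measurable (X v))
    (hX_nonneg : ∀ v, ∀ᵐ ω ∂μ, 0 ≤ X v ω) (hX_indep : iIndepFun X μ)
    (hX_tail : ∀ v, Tendsto (fun y => y ^ α * μ.real {ω | y < X v ω}) atTop (𝓝 K))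
    {h : (V → ℝ) → ℝ} (hh : ∀ x, 0 ≤ x → 0 ≤ h x)
    (hhom : ∀ t : ℝ, 0 < t → ∀ x, 0 ≤ x → h (t • x) = t * h x) {C : ℝ} (hC : 0 < C)
    (hbd : ∀ x, 0 ≤ x → h x ≤ C * ∑ v, x v)
    (hcont : ∀ v, ContinuousWithinAt h (Set.Ici 0) (Pi.single v 1)) :
    Tendsto (fun y => y ^ α * μ.real {ω | y < h fun v => X v ω}) atTop
      (𝓝 (K * ∑ v, h (Pi.single v 1) ^ α)) := by
  have hX0 : ∀ᵐ ω ∂μ, (0 : V → ℝ) ≤ fun v => X v ω := ae_all_iff.2 hX_nonneg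
  have hs0 : ∀ v, (0 : V → ℝ) ≤ Pi.single v 1 := fun v => Pi.single_nonneg.2 zero_le_one
  have hsC : ∀ v, h (Pi.single v 1) ≤ C := fun v => by
    simpa using hbd _ (hs0 v)
  set ε : ℝ := (C * (Fintype.card V + 1))⁻¹ with hε
  have hε0 : 0 < ε := by positivity
  have hεC : ε * C ≤ 1 := by
    have h1 : ((Fintype.card V : ℝ) + 1)⁻¹ ≤ 1 := inv_le_one_of_one_le₀ (by simp)
    calc ε * C = ((Fintype.card V : ℝ) + 1)⁻¹ := by rw [hε]; field_simp
      _ ≤ 1 := h1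
  -- The error term of both bounds: two distinct weights that are simultaneously large.
  have hpair : ∀ δ : ℝ, 0 < δ → Tendsto (fun y => ∑ v, ∑ w ∈ Finset.univ.erase v,
      y ^ α * μ.real {ω | ε * y < X v ω ∧ δ * ε * y < X w ω}) atTop (𝓝 0) := fun δ hδ => by
    have : Tendsto (fun y : ℝ => ∑ v, ∑ w ∈ Finset.univ.erase v,
        y ^ α * μ.real {ω | ε * y < X v ω ∧ δ * ε * y < X w ω}) atTop
        (𝓝 (∑ v : V, ∑ w ∈ Finset.univ.erase v, (0 : ℝ))) :=
      tendsto_finsetSum _ fun v _ => tendsto_finsetSum _ fun w hw =>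
        tendsto_rpow_mul_joint_tail hα (hX_tail v) (hX_tail w)
          (hX_indep.indepFun (Finset.ne_of_mem_erase hw).symm) hε0 (by positivity)
    simpa using this
  refine tendsto_order.2 ⟨fun l hl => ?_, fun l hl => ?_⟩
  -- Lower bound. The slack κ is fixed first, then the cone width δ. Truncation at 0 keeps the
  -- coefficients nonnegative when h(e_v) < κ.
  · have hlim : Tendsto (fun κ : ℝ => K * ∑ v, max (h (Pi.single v 1) - κ) 0 ^ α) (𝓝[>] 0)
        (𝓝 (K * ∑ v, h (Pi.single v 1) ^ α)) := by
      have hc : Continuous fun κ : ℝ => K * ∑ v, max (h (Pi.single v 1) - κ) 0 ^ α :=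
        continuous_const.mul (continuous_finsetSum _ fun v _ =>
          ((continuous_const.sub continuous_id).max continuous_const).rpow_const
            fun _ => Or.inr hα.le)
      have h0 := (hc.tendsto 0).mono_left (nhdsWithin_le_nhds (s := Set.Ioi 0))
      simpa only [sub_zero, max_eq_left (hh _ (hs0 _))] using h0
    obtain ⟨κ, hlκ, hκ⟩ :=
      ((hlim.eventually_const_lt hl).and eventually_mem_nhdsWithin).exists
    obtain ⟨δ, hδ, hδ1, hcone⟩ := exists_cone_bound hhom hcont hκ
    set a : V → ℝ := fun v => max (h (Pi.single v 1) - κ) 0 with ha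
    have hlow : Tendsto (fun y => ∑ v, y ^ α * μ.real {ω | y < a v * X v ω} -
        ∑ v, ∑ w ∈ Finset.univ.erase v,
          y ^ α * μ.real {ω | ε * y < X v ω ∧ δ * ε * y < X w ω}) atTop
        (𝓝 (K * ∑ v, a v ^ α - 0)) := by
      rw [Finset.mul_sum]
      exact (tendsto_finsetSum _ fun v _ => tendsto_rpow_mul_tail_const_mul hα (hX_tail v)
        (le_max_right _ _)).sub (hpair δ hδ)
    rw [sub_zero] at hlow
    filter_upwards [hlow.eventually_const_lt hlκ, eventually_gt_atTop 0] with y hy hy0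
    refine hy.trans_le (sub_le_iff_le_add.2 ?_)
    simp only [← Finset.mul_sum, ← mul_add]
    refine mul_le_mul_of_nonneg_left ?_ (Real.rpow_nonneg hy0.le _)
    have hay : ∀ v ω, y < a v * X v ω → 0 ≤ X v ω → ε * y < X v ω ∧ 0 < a v := fun v ω hlt h0 => by
      have hav0 : 0 ≤ a v := le_max_right _ _
      have hav : a v ≤ C := max_le ((sub_le_self _ (le_of_lt hκ)).trans (hsC v)) hC.le
      refine ⟨?_, lt_of_le_of_ne hav0 fun h => ?_⟩
      · have h1 : y < C * X v ω := hlt.trans_le (mul_le_mul_of_nonneg_right hav h0)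
        calc ε * y < ε * (C * X v ω) := mul_lt_mul_of_pos_left h1 hε0
          _ = ε * C * X v ω := by ring
          _ ≤ X v ω := mul_le_of_le_one_left h0 hεC
      · rw [← h, zero_mul] at hlt
        exact absurd hlt hy0.not_gt
    -- On `G v` the weight at v is the only large one. These events are disjoint because δ ≤ 1, so
    -- their probabilities add up to at most the tail of h(X).
    set G : V → Set Ω := fun v =>
      {ω | y < a v * X v ω ∧ ε * y < X v ω ∧ ∀ w, w ≠ v → X w ω ≤ δ * ε * y} with hG
    have hGm : ∀ v, MeasurableSet (G v) := fun v => by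
      have hall : MeasurableSet {ω | ∀ w, w ≠ v → X w ω ≤ δ * ε * y} := by
        simp only [Set.ofPred_forall]
        exact MeasurableSet.iInter fun w => MeasurableSet.iInter fun _ =>
          measurableSet_le (hX_meas w) measurable_const
      exact (measurableSet_lt measurable_const ((hX_meas v).const_mul _)).inter
        ((measurableSet_lt measurable_const (hX_meas v)).inter hall)
    have hGd : Pairwise (Function.onFun Disjoint G) := fun v w hvw => by
      refine Set.disjoint_left.2 fun ω h1 h2 => ?_
      have h3 := h1.2.2 w hvw.symm
      have h4 := h2.2.1
      have h5 : δ * (ε * y) ≤ ε * y := mul_le_of_le_one_left (by positivity) hδ1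
      rw [mul_assoc] at h3
      linarith
    have hGle : ∑ v, μ.real (G v) ≤ μ.real {ω | y < h fun v => X v ω} := by
      rw [← measureReal_iUnion_fintype hGd hGm]
      refine measureReal_mono_of_ae ?_
      filter_upwards [hX0] with ω h0 hω
      obtain ⟨v, h1, h2, h3⟩ := Set.mem_iUnion.1 hω
      have hv : 0 < X v ω := lt_trans (by positivity) h2
      have h4 := hcone v (fun v => X v ω) h0 hv fun w hw => by
        refine (h3 w hw).trans ?_
        rw [mul_assoc]
        exact mul_le_mul_of_nonneg_left h2.le hδ.le
      have h5 := (hay v ω h1 (h0 v)).2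
      have h6 : a v = h (Pi.single v 1) - κ := by
        rcases max_choice (h (Pi.single v 1) - κ) 0 with h | h
        · exact h
        · exact absurd h h5.ne'
      rw [h6] at h1
      have h7 := (abs_le.1 h4).1
      change y < h fun v => X v ω
      linarith
    have hAle : ∀ v, μ.real {ω | y < a v * X v ω} ≤ μ.real (G v) +
        ∑ w ∈ Finset.univ.erase v, μ.real {ω | ε * y < X v ω ∧ δ * ε * y < X w ω} := fun v => by
      refine le_trans ?_ (add_le_add_right (measureReal_biUnion_finset_le _ _) _)
      refine le_trans ?_ (measureReal_union_le _ _)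
      refine measureReal_mono_of_ae ?_
      filter_upwards [hX0] with ω h0 hω
      have h1 := (hay v ω hω (h0 v)).1
      by_cases h2 : ∀ w, w ≠ v → X w ω ≤ δ * ε * y
      · exact Or.inl ⟨hω, h1, h2⟩
      · push Not at h2
        obtain ⟨w, hw, h2⟩ := h2
        exact Or.inr (Set.mem_biUnion (Finset.mem_erase.2 ⟨hw, Finset.mem_univ w⟩) ⟨h1, h2⟩)
    calc ∑ v, μ.real {ω | y < a v * X v ω} ≤ _ := Finset.sum_le_sum fun v _ => hAle v
      _ = _ := Finset.sum_add_distrib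
      _ ≤ _ := add_le_add_left hGle _
  -- Upper bound, with coefficients enlarged by κ; a union bound suffices and no disjointness is
  -- needed.
  · have hlim : Tendsto (fun κ : ℝ => K * ∑ v, (h (Pi.single v 1) + κ) ^ α) (𝓝[>] 0)
        (𝓝 (K * ∑ v, h (Pi.single v 1) ^ α)) := by
      have hc : Continuous fun κ : ℝ => K * ∑ v, (h (Pi.single v 1) + κ) ^ α :=
        continuous_const.mul (continuous_finsetSum _ fun v _ =>
          (continuous_const.add continuous_id).rpow_const fun _ => Or.inr hα.le)
      have h0 := (hc.tendsto 0).mono_left (nhdsWithin_le_nhds (s := Set.Ioi 0))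
      simpa only [add_zero] using h0
    obtain ⟨κ, hlκ, hκ⟩ :=
      ((hlim.eventually_lt_const hl).and eventually_mem_nhdsWithin).exists
    obtain ⟨δ, hδ, hδ1, hcone⟩ := exists_cone_bound hhom hcont hκ
    have hup : Tendsto (fun y => ∑ v, y ^ α * μ.real {ω | y < (h (Pi.single v 1) + κ) * X v ω} +
        ∑ v, ∑ w ∈ Finset.univ.erase v,
          y ^ α * μ.real {ω | ε * y < X v ω ∧ δ * ε * y < X w ω}) atTop
        (𝓝 (K * ∑ v, (h (Pi.single v 1) + κ) ^ α + 0)) := by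
      rw [Finset.mul_sum]
      exact (tendsto_finsetSum _ fun v _ => tendsto_rpow_mul_tail_const_mul hα (hX_tail v)
        (add_nonneg (hh _ (hs0 v)) (le_of_lt hκ))).add (hpair δ hδ)
    rw [add_zero] at hup
    filter_upwards [hup.eventually_lt_const hlκ, eventually_gt_atTop 0] with y hy hy0
    refine lt_of_le_of_lt ?_ hy
    simp only [← Finset.mul_sum, ← mul_add]
    refine mul_le_mul_of_nonneg_left ?_ (Real.rpow_nonneg hy0.le _)
    refine le_trans ?_ (add_le_add (measureReal_iUnion_fintype_le _)
      (Finset.sum_le_sum fun v _ => measureReal_biUnion_finset_le _ _))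
    refine le_trans ?_ (add_le_add_right (measureReal_iUnion_fintype_le _) _)
    refine le_trans ?_ (measureReal_union_le _ _)
    refine measureReal_mono_of_ae ?_
    filter_upwards [hX0] with ω h0 hω
    -- The linear bound on h forces one weight above ε y. Either all others are at most δ ε y and
    -- the cone estimate applies, or a pair event occurs.
    obtain ⟨v, hv⟩ := exists_lt_of_lt_sum hC hy0 (lt_of_lt_of_le hω (hbd _ h0))
    by_cases h2 : ∀ w, w ≠ v → X w ω ≤ δ * ε * y
    · refine Or.inl (Set.mem_iUnion.2 ⟨v, ?_⟩)
      have hv0 : 0 < X v ω := lt_trans (by positivity) hv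
      have h4 := hcone v (fun v => X v ω) h0 hv0 fun w hw => by
        refine (h2 w hw).trans ?_
        rw [mul_assoc]
        exact mul_le_mul_of_nonneg_left (le_of_lt hv) hδ.le
      have h7 := (abs_le.1 h4).2
      have h8 : y < h fun v => X v ω := hω
      change y < (h (Pi.single v 1) + κ) * X v ω
      linarith
    · push Not at h2
      obtain ⟨w, hw, h2⟩ := h2
      exact Or.inr (Set.mem_iUnion.2
        ⟨v, Set.mem_biUnion (Finset.mem_erase.2 ⟨hw, Finset.mem_univ w⟩) ⟨hv, h2⟩⟩)

/-- Single-big-jump principle for a randomly perturbed positively homogeneous function. -/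
theorem tendsto_rpow_mul_tail_random_homogeneous (hα : 0 < α) (hX_meas : ∀ v, Measurable (X v))
    (hX_nonneg : ∀ v, ∀ᵐ ω ∂μ, 0 ≤ X v ω) (hX_indep : iIndepFun X μ)
    (hX_tail : ∀ v, Tendsto (fun y => y ^ α * μ.real {ω | y < X v ω}) atTop (𝓝 K))
    {N : Type*} [MeasurableSpace N] {Z : Ω → N} (hZ : Measurable Z)
    (hXZ : IndepFun (fun ω v => X v ω) Z μ)
    {H : (V → ℝ) × N → ℝ} (hH : Measurable H) (hH0 : ∀ x z, 0 ≤ x → 0 ≤ H (x, z))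
    (hhom : ∀ z, ∀ t : ℝ, 0 < t → ∀ x, 0 ≤ x → H (t • x, z) = t * H (x, z)) {C : ℝ} (hC : 0 < C)
    (hbd : ∀ x z, 0 ≤ x → H (x, z) ≤ C * ∑ v, x v)
    (hcont : ∀ v, ∀ᵐ ω ∂μ, ContinuousWithinAt (fun x => H (x, Z ω)) (Set.Ici 0) (Pi.single v 1)) :
    (∀ v, Integrable (fun ω => H (Pi.single v 1, Z ω) ^ α) μ) ∧
    Tendsto (fun y => y ^ α * μ.real {ω | y < H (fun v => X v ω, Z ω)}) atTop
      (𝓝 (K * ∑ v, ∫ ω, H (Pi.single v 1, Z ω) ^ α ∂μ)) := by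
  have hX0 : ∀ᵐ ω ∂μ, (0 : V → ℝ) ≤ fun v => X v ω := ae_all_iff.2 hX_nonneg
  have hs0 : ∀ v, (0 : V → ℝ) ≤ Pi.single v 1 := fun v => Pi.single_nonneg.2 zero_le_one
  have hXm : Measurable fun ω v => X v ω := measurable_pi_lambda _ hX_meas
  have hint : ∀ v, Integrable (fun ω => H (Pi.single v 1, Z ω) ^ α) μ := fun v => by
    refine Integrable.of_bound (C := C ^ α)
      ((hH.comp (measurable_const.prodMk hZ)).pow_const α).aestronglyMeasurable
      (Eventually.of_forall fun ω => ?_)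
    have h0 := hH0 (Pi.single v 1) (Z ω) (hs0 v)
    rw [Real.norm_of_nonneg (Real.rpow_nonneg h0 α)]
    exact Real.rpow_le_rpow h0 (by simpa using hbd _ (Z ω) (hs0 v)) hα.le
  refine ⟨hint, ?_⟩
  rw [← integral_finsetSum _ fun v _ => hint v, ← integral_const_mul]
  -- Independence and Fubini write the tail as an average over the noise of tails with frozen noise.
  have hfib : ∀ y, μ.real {ω | y < H (fun v => X v ω, Z ω)} =
      ∫ ω', μ.real {ω | y < H (fun v => X v ω, Z ω')} ∂μ := fun y => by
    have hS : MeasurableSet {q : (V → ℝ) × N | y < H q} := measurableSet_lt measurable_const hH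
    have hprod := (indepFun_iff_map_prod_eq_prod_map_map hXm.aemeasurable hZ.aemeasurable).1 hXZ
    have h1 : μ {ω | y < H (fun v => X v ω, Z ω)} =
        ∫⁻ ω', μ {ω | y < H (fun v => X v ω, Z ω')} ∂μ := by
      calc μ {ω | y < H (fun v => X v ω, Z ω)}
          = μ.map (fun ω => ((fun v => X v ω), Z ω)) {q | y < H q} :=
            (Measure.map_apply (hXm.prodMk hZ) hS).symm
        _ = ∫⁻ z, μ.map (fun ω v => X v ω) ((fun x => (x, z)) ⁻¹' {q | y < H q}) ∂μ.map Z := by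
            rw [hprod]
            have := Measure.isProbabilityMeasure_map (μ := μ) hXm.aemeasurable
            have := Measure.isProbabilityMeasure_map (μ := μ) hZ.aemeasurable
            exact Measure.prod_apply_symm hS
        _ = ∫⁻ ω', μ.map (fun ω v => X v ω) ((fun x => (x, Z ω')) ⁻¹' {q | y < H q}) ∂μ := by
            have := Measure.isProbabilityMeasure_map (μ := μ) hXm.aemeasurable
            exact lintegral_map (measurable_measure_prodMk_right hS) hZ
        _ = _ := lintegral_congr fun ω' =>
            Measure.map_apply hXm (measurable_prodMk_right hS)
    have h2 : Measurable fun ω' => μ {ω | y < H (fun v => X v ω, Z ω')} := by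
      have hS' : MeasurableSet {q : Ω × Ω | y < H (fun v => X v q.1, Z q.2)} :=
        measurableSet_lt measurable_const
          (hH.comp ((hXm.comp measurable_fst).prodMk (hZ.comp measurable_snd)))
      exact measurable_measure_prodMk_right hS'
    rw [measureReal_def, h1]
    exact (integral_toReal h2.aemeasurable
      (Eventually.of_forall fun _ => measure_lt_top _ _)).symm
  have hmeas : ∀ y, Measurable fun ω' => μ.real {ω | y < H (fun v => X v ω, Z ω')} := fun y => by
    have hS' : MeasurableSet {q : Ω × Ω | y < H (fun v => X v q.1, Z q.2)} :=
      measurableSet_lt measurable_const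
        (hH.comp ((hXm.comp measurable_fst).prodMk (hZ.comp measurable_snd)))
    exact (measurable_measure_prodMk_right hS').ennreal_toReal
  simp only [hfib, ← integral_const_mul]
  set ε : ℝ := (C * (Fintype.card V + 1))⁻¹ with hε
  have hε0 : 0 < ε := by positivity
  have hsum : Tendsto (fun y => ∑ v, y ^ α * μ.real {ω | ε * y < X v ω}) atTop
      (𝓝 (∑ _v : V, ε ^ (-α) * K)) :=
    tendsto_finsetSum _ fun v _ => tendsto_rpow_mul_comp_mul (hX_tail v) hε0
  -- The dominating constant comes from the linear bound: for every frozen noise the tail is at most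
  -- the sum of the probabilities of X_v > ε y, and y^α times this sum converges.
  refine tendsto_integral_filter_of_dominated_convergence
    (fun _ => ∑ _v : V, ε ^ (-α) * K + 1) ?_ ?_ (integrable_const _) ?_
  · exact Eventually.of_forall fun y => ((hmeas y).const_mul _).aestronglyMeasurable
  · filter_upwards [hsum.eventually_le_const (lt_add_one _), eventually_gt_atTop 0] with y hy hy0
    refine Eventually.of_forall fun ω' => ?_
    rw [Real.norm_of_nonneg (mul_nonneg (Real.rpow_nonneg hy0.le _) measureReal_nonneg)]
    refine le_trans ?_ hy
    rw [← Finset.mul_sum]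
    refine mul_le_mul_of_nonneg_left ?_ (Real.rpow_nonneg hy0.le _)
    refine le_trans ?_ (measureReal_iUnion_fintype_le _)
    refine measureReal_mono_of_ae ?_
    filter_upwards [hX0] with ω h0 hω
    exact Set.mem_iUnion.2 (exists_lt_of_lt_sum hC hy0 (lt_of_lt_of_le hω (hbd _ _ h0)))
  · filter_upwards [ae_all_iff.2 hcont] with ω' hω'
    exact tendsto_rpow_mul_tail_homogeneous hα hX_meas hX_nonneg hX_indep hX_tail
      (h := fun x => H (x, Z ω')) (fun x hx => hH0 x _ hx) (hhom _) hC (fun x hx => hbd x _ hx) hω'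

end BigJump

namespace TrafficModel

/-! ### Almost sure regularity of the marks and the measurable cost function -/

section Randomness

open scoped Classical

variable {V : Type*} [Fintype V] (M : TrafficModel V)

variable {Ω : Type*} [MeasurableSpace Ω] {μ : Measure Ω}
  {u : Ω → ℝ} {e₁ : Ω → M.Edge} {ξ : ℕ × M.Edge → Ω → ℝ}

lemma IsCascadeNoise.measurable_marks (h : M.IsCascadeNoise μ u e₁ ξ) :
    Measurable fun ω => (e₁ ω, fun i => ξ i ω) :=
  h.measurable_e₁.prodMk (measurable_pi_lambda _ h.measurable_ξ)

lemma IsCascadeNoise.measurable_noise (h : M.IsCascadeNoise μ u e₁ ξ) :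
    Measurable fun ω => (u ω, e₁ ω, fun i => ξ i ω) :=
  h.measurable_u.prodMk h.measurable_marks

lemma IsCascadeNoise.measure_mark_mem_finite (h : M.IsCascadeNoise μ u e₁ ξ) (i : ℕ × M.Edge)
    {F : Set ℝ} (hF : F.Finite) : μ {ω | ξ i ω ∈ F} = 0 := by
  have h1 : μ.map (ξ i) F = 0 := by
    rw [h.ξ_uniform]
    exact hF.measure_zero _
  rwa [Measure.map_apply (h.measurable_ξ i) hF.measurableSet] at h1

/-- Measurability of the bad event, required to test nullity of a product measure through its
sections. The constraint on the first coordinate keeps the capacities positive. -/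
lemma measurableSet_mark_eq {x : V → ℝ} (hx : 0 ≤ x) (hx0 : x ≠ 0) (r : ℕ) (e : M.Edge) :
    MeasurableSet {q : ℝ × M.Edge × (ℕ × M.Edge → ℝ) | q.1 ∈ Set.Icc M.lm M.lM ∧
      q.2.2 (r + 2, e) =
        M.p (r + 2) e (M.exceedance x (M.cascade x q.1 q.2.1 q.2.2 (r + 1)) e)} := by
  set D : Set (ℝ × M.Edge × (ℕ × M.Edge → ℝ)) := {q | q.1 ∈ Set.Icc M.lm M.lM} with hD
  have hDm : MeasurableSet D := measurable_fst measurableSet_Icc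
  have hc := (M.measurable_cascade (S := D) (x := fun _ => x) (u := fun q => q.1.1)
    (e₁ := fun q => q.1.2.1) (ξ := fun q => q.1.2.2) measurable_const (fun _ => hx)
    (fun _ => hx0) (measurable_fst.comp measurable_subtype_coe) (fun q => q.2)
    (measurable_fst.comp (measurable_snd.comp measurable_subtype_coe))
    (measurable_snd.comp (measurable_snd.comp measurable_subtype_coe)) (r + 1)).1
  have hpos : ∀ (q : D) e, 0 < (M.cascade x q.1.1 q.1.2.1 q.1.2.2 (r + 1)).capacity e := fun q =>
    M.cascade_capacity_pos hx hx0 q.2 (r + 1)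
  have hψ := M.measurable_exceedance_comp (x := fun _ => x) measurable_const (fun _ => hx) hc hpos e
  have hp := (M.p_cont (r + 2) e).measurable_comp_of_forall_mem hψ
    fun q => M.exceedance_nonneg hx (fun e => (hpos q e).le) e
  have hξ : Measurable fun q : D => q.1.2.2 (r + 2, e) :=
    (measurable_pi_apply _).comp (measurable_snd.comp (measurable_snd.comp measurable_subtype_coe))
  have h1 := hDm.subtype_image (measurableSet_eq_fun hξ hp)
  convert h1 using 1
  ext q
  constructor
  · rintro ⟨h1, h2⟩
    exact ⟨⟨q, h1⟩, h2, rfl⟩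
  · rintro ⟨q', h2, rfl⟩
    exact ⟨q'.2, h2⟩

/-- Given the reduction factor, the previous stage has finitely many possible states over all
initial edges and marks. Hence the mark would have to hit a fixed finite set, which a uniform
variable does with probability 0. -/
lemma IsCascadeNoise.ae_isRegularMark [IsProbabilityMeasure μ]
    (h : M.IsCascadeNoise μ u e₁ ξ) {x : V → ℝ} (hx : 0 ≤ x)
    (hx0 : x ≠ 0) : ∀ᵐ ω ∂μ, M.IsRegularMark x (u ω) (e₁ ω) (fun i => ξ i ω) := by
  refine Eventually.and (ae_all_iff.2 fun i => ?_) (ae_all_iff.2 fun r => ae_all_iff.2 fun e => ?_)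
  · have h1 : ∀ᵐ z ∂μ.map (ξ i), z ∈ Set.Icc (0 : ℝ) 1 := by
      rw [h.ξ_uniform]
      exact ae_restrict_mem measurableSet_Icc
    exact (ae_of_ae_map (h.measurable_ξ i).aemeasurable h1).mono fun ω hω => hω.1
  · have hT := M.measurableSet_mark_eq hx hx0 r e
    set T := {q : ℝ × M.Edge × (ℕ × M.Edge → ℝ) | q.1 ∈ Set.Icc M.lm M.lM ∧
      q.2.2 (r + 2, e) =
        M.p (r + 2) e (M.exceedance x (M.cascade x q.1 q.2.1 q.2.2 (r + 1)) e)} with hTdef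
    have hprod := (indepFun_iff_map_prod_eq_prod_map_map h.measurable_u.aemeasurable
      h.measurable_marks.aemeasurable).1 h.indep_u
    have hnull : μ.map (fun ω => (u ω, e₁ ω, fun i => ξ i ω)) T = 0 := by
      rw [hprod]
      have := Measure.isProbabilityMeasure_map (μ := μ) h.measurable_u.aemeasurable
      have := Measure.isProbabilityMeasure_map (μ := μ) h.measurable_marks.aemeasurable
      -- Fubini in u: its law may be continuous, so finiteness holds only section by section.
      refine (Measure.measure_prod_null hT).2 (Eventually.of_forall fun t => ?_)
      set F : Set ℝ := ⋃ a : M.Edge, (fun s => M.p (r + 2) e (M.exceedance x s e)) ''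
        Set.range fun ζ => M.cascade x t a ζ (r + 1) with hF
      have hFfin : F.Finite :=
        Set.finite_iUnion fun a => (M.finite_range_cascade x t a (r + 1)).image _
      refine measure_mono_null (t := {q | q.2 (r + 2, e) ∈ F}) ?_ ?_
      · rintro ⟨a, ζ⟩ ⟨-, h2⟩
        exact Set.mem_iUnion.2 ⟨a, _, ⟨ζ, rfl⟩, h2.symm⟩
      · have hFm : MeasurableSet
            {q : M.Edge × (ℕ × M.Edge → ℝ) | q.2 (r + 2, e) ∈ F} :=
          ((measurable_pi_apply _).comp measurable_snd) hFfin.measurableSet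
        rw [Measure.map_apply h.measurable_marks hFm]
        exact h.measure_mark_mem_finite M _ hFfin
    rw [Measure.map_apply h.measurable_noise hT] at hnull
    filter_upwards [h.u_mem, measure_eq_zero_iff_ae_notMem.1 hnull] with ω h1 h2 h3
    exact h2 ⟨h1, h3⟩

/-- The congestion cost as a function of weights and noise, set to zero outside the admissible
range. -/
noncomputable def admissibleCost (r : ℕ) :
    (V → ℝ) × (ℝ × M.Edge × (ℕ × M.Edge → ℝ)) → ℝ :=
  {q | 0 ≤ q.1 ∧ q.1 ≠ 0 ∧ q.2.1 ∈ Set.Icc M.lm M.lM}.indicator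
    fun q => M.congestionCost q.1 q.2.1 q.2.2.1 q.2.2.2 r

lemma measurable_admissibleCost (r : ℕ) : Measurable (M.admissibleCost r) := by
  set D := {q : (V → ℝ) × (ℝ × M.Edge × (ℕ × M.Edge → ℝ)) |
    0 ≤ q.1 ∧ q.1 ≠ 0 ∧ q.2.1 ∈ Set.Icc M.lm M.lM} with hD
  have hDm : MeasurableSet D :=
    (measurable_fst measurableSet_Ici).inter
      ((measurable_fst (measurableSet_singleton (0 : V → ℝ)).compl).inter
        ((measurable_fst.comp measurable_snd) measurableSet_Icc))
  have hm := M.measurable_congestionCost_comp (S := D) (x := fun q => q.1.1)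
    (u := fun q => q.1.2.1) (e₁ := fun q => q.1.2.2.1) (ξ := fun q => q.1.2.2.2)
    (measurable_fst.comp measurable_subtype_coe) (fun q => q.2.1) (fun q => q.2.2.1)
    (measurable_fst.comp (measurable_snd.comp measurable_subtype_coe)) (fun q => q.2.2.2)
    (measurable_fst.comp (measurable_snd.comp (measurable_snd.comp measurable_subtype_coe)))
    (measurable_snd.comp (measurable_snd.comp (measurable_snd.comp measurable_subtype_coe))) r
  refine measurable_of_restrict_of_restrict_compl hDm ?_ ?_
  · have h : D.domRestrict (M.admissibleCost r) =
        fun q : D => M.congestionCost q.1.1 q.1.2.1 q.1.2.2.1 q.1.2.2.2 r :=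
      funext fun q => by
        rw [Set.domRestrict_apply, admissibleCost]
        exact Set.indicator_of_mem q.2 _
    rwa [h]
  · have h : Dᶜ.domRestrict (M.admissibleCost r) = fun _ => 0 :=
      funext fun q => by
        rw [Set.domRestrict_apply, admissibleCost]
        exact Set.indicator_of_notMem q.2 _
    rw [h]
    exact measurable_const

variable {x : V → ℝ} {z : ℝ × M.Edge × (ℕ × M.Edge → ℝ)}

/-- Zero weights are outside the support because capacities vanish there; nothing is lost, as the
congestion cost is then 0. -/
lemma admissibleCost_eq (hx : 0 ≤ x) (hz : z.1 ∈ Set.Icc M.lm M.lM) (r : ℕ) :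
    M.admissibleCost r (x, z) = M.congestionCost x z.1 z.2.1 z.2.2 r := by
  by_cases hx0 : x = 0
  · subst hx0
    rw [M.congestionCost_zero hz]
    exact Set.indicator_of_notMem (fun h => h.2.1 rfl) _
  · exact Set.indicator_of_mem (s := {q : (V → ℝ) × (ℝ × M.Edge × (ℕ × M.Edge → ℝ)) |
      0 ≤ q.1 ∧ q.1 ≠ 0 ∧ q.2.1 ∈ Set.Icc M.lm M.lM}) ⟨hx, hx0, hz⟩ _

lemma admissibleCost_eq_zero (hz : z.1 ∉ Set.Icc M.lm M.lM) (r : ℕ) :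
    M.admissibleCost r (x, z) = 0 :=
  Set.indicator_of_notMem (fun h => hz h.2.2) _

lemma admissibleCost_nonneg (hx : 0 ≤ x) (r : ℕ) : 0 ≤ M.admissibleCost r (x, z) := by
  by_cases hz : z.1 ∈ Set.Icc M.lm M.lM
  · rw [M.admissibleCost_eq hx hz]
    exact M.congestionCost_nonneg hx hz r
  · rw [M.admissibleCost_eq_zero hz]

lemma admissibleCost_smul {t : ℝ} (ht : 0 < t) (hx : 0 ≤ x) (r : ℕ) :
    M.admissibleCost r (t • x, z) = t * M.admissibleCost r (x, z) := by
  by_cases hz : z.1 ∈ Set.Icc M.lm M.lM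
  · rw [M.admissibleCost_eq hx hz, M.admissibleCost_eq (smul_nonneg ht.le hx) hz]
    by_cases hx0 : x = 0
    · subst hx0
      rw [smul_zero, M.congestionCost_zero hz, mul_zero]
    · exact M.congestionCost_smul ht hx hx0 hz r
  · rw [M.admissibleCost_eq_zero hz, M.admissibleCost_eq_zero hz, mul_zero]

lemma continuousWithinAt_admissibleCost (hx : 0 ≤ x) (hx0 : x ≠ 0)
    (hz : z.1 ∈ Set.Icc M.lm M.lM) (hξ : M.IsRegularMark x z.1 z.2.1 z.2.2) (r : ℕ) :
    ContinuousWithinAt (fun x => M.admissibleCost r (x, z)) (Set.Ici 0) x :=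
  (M.continuousWithinAt_congestionCost hx hx0 hz hξ r).congr
    (fun _ hy => M.admissibleCost_eq hy hz r) (M.admissibleCost_eq hx hz r)

end Randomness

/-! ### The tail at a fixed stage, positivity of the constant, and the theorem -/

section Main

open scoped Classical

variable {V : Type*} [Fintype V] (M : TrafficModel V)

variable {Ω : Type*} [MeasurableSpace Ω] {μ : Measure Ω} {α K : ℝ}
  {X : V → Ω → ℝ} {u : Ω → ℝ} {e₁ : Ω → M.Edge} {ξ : ℕ × M.Edge → Ω → ℝ}

lemma ae_congestionCost_eq (hX_nonneg : ∀ v, ∀ᵐ ω ∂μ, 0 ≤ X v ω)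
    (hnoise : M.IsCascadeNoise μ u e₁ ξ) (r : ℕ) :
    (fun ω => M.congestionCost (fun v => X v ω) (u ω) (e₁ ω) (fun i => ξ i ω) r) =ᵐ[μ]
      fun ω => M.admissibleCost r (fun v => X v ω, u ω, e₁ ω, fun i => ξ i ω) := by
  filter_upwards [ae_all_iff.2 hX_nonneg, hnoise.u_mem] with ω h1 h2
  exact (M.admissibleCost_eq (z := (u ω, e₁ ω, fun i => ξ i ω)) h1 h2 r).symm

lemma aemeasurable_congestionCost (hX_meas : ∀ v, Measurable (X v))
    (hX_nonneg : ∀ v, ∀ᵐ ω ∂μ, 0 ≤ X v ω) (hnoise : M.IsCascadeNoise μ u e₁ ξ) (r : ℕ) :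
    AEMeasurable
      (fun ω => M.congestionCost (fun v => X v ω) (u ω) (e₁ ω) (fun i => ξ i ω) r) μ :=
  ⟨_, (M.measurable_admissibleCost r).comp
    ((measurable_pi_lambda _ hX_meas).prodMk hnoise.measurable_noise),
    M.ae_congestionCost_eq hX_nonneg hnoise r⟩

lemma ae_unitCost_eq (hnoise : M.IsCascadeNoise μ u e₁ ξ) (v : V) (r : ℕ) :
    (fun ω => M.unitCost v u e₁ ξ r ω) =ᵐ[μ]
      fun ω => M.admissibleCost r (Pi.single v 1, u ω, e₁ ω, fun i => ξ i ω) := by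
  filter_upwards [hnoise.u_mem] with ω h2
  exact (M.admissibleCost_eq (z := (u ω, e₁ ω, fun i => ξ i ω))
    (Pi.single_nonneg.2 zero_le_one) h2 r).symm

/-- The tail of the congestion cost at a fixed stage, as a limit. -/
lemma integrable_and_tendsto_congestionCost_tail [IsProbabilityMeasure μ] (hα : 0 < α) (hK : 0 < K)
    (hX_meas : ∀ v, Measurable (X v)) (hX_nonneg : ∀ v, ∀ᵐ ω ∂μ, 0 ≤ X v ω)
    (hX_indep : iIndepFun X μ)
    (hX_tail : ∀ v, (fun x : ℝ => μ.real {ω | x < X v ω}) ~[atTop] fun x => K * x ^ (-α))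
    (hnoise : M.IsCascadeNoise μ u e₁ ξ)
    (hindep : IndepFun (fun ω v => X v ω) (fun ω => (u ω, e₁ ω, fun i => ξ i ω)) μ) (r : ℕ) :
    (∀ v, Integrable (fun ω => M.unitCost v u e₁ ξ r ω ^ α) μ) ∧
    Tendsto (fun y : ℝ => y ^ α * μ.real
      {ω | y < M.congestionCost (fun v => X v ω) (u ω) (e₁ ω) (fun i => ξ i ω) r}) atTop
      (𝓝 (M.tailConst μ K α u e₁ ξ r)) := by
  obtain ⟨C, hC, hbd⟩ := M.exists_congestionCost_le r
  have hunit : ∀ v, (fun ω => M.unitCost v u e₁ ξ r ω ^ α) =ᵐ[μ]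
      fun ω => M.admissibleCost r (Pi.single v 1, u ω, e₁ ω, fun i => ξ i ω) ^ α := fun v =>
    (M.ae_unitCost_eq hnoise v r).mono fun ω hω => congrArg (· ^ α) hω
  have hle : ∀ (x : V → ℝ) (z : ℝ × M.Edge × (ℕ × M.Edge → ℝ)), 0 ≤ x →
      M.admissibleCost r (x, z) ≤ C * ∑ v, x v := fun x z hx => by
    by_cases hz : z.1 ∈ Set.Icc M.lm M.lM
    · rw [M.admissibleCost_eq hx hz]
      exact hbd x _ _ _ hx hz
    · rw [M.admissibleCost_eq_zero hz]
      exact mul_nonneg hC.le (sum_nonneg_of_nonneg hx)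
  have hcont : ∀ v, ∀ᵐ ω ∂μ, ContinuousWithinAt
      (fun x => M.admissibleCost r (x, (u ω, e₁ ω, fun i => ξ i ω))) (Set.Ici 0)
      (Pi.single v 1) := fun v => by
    have hv : (0 : V → ℝ) ≤ Pi.single v 1 := Pi.single_nonneg.2 zero_le_one
    have hv0 : (Pi.single v 1 : V → ℝ) ≠ 0 := Pi.single_ne_zero_iff.2 one_ne_zero
    filter_upwards [hnoise.u_mem, hnoise.ae_isRegularMark M hv hv0] with ω hω hω'
    exact M.continuousWithinAt_admissibleCost (z := (u ω, e₁ ω, fun i => ξ i ω)) hv hv0 hω hω' r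
  obtain ⟨h1, h2⟩ := tendsto_rpow_mul_tail_random_homogeneous hα hX_meas hX_nonneg hX_indep
    (fun v => tendsto_rpow_mul_of_isEquivalent hK.ne' (hX_tail v)) hnoise.measurable_noise hindep
    (M.measurable_admissibleCost r) (fun x z hx => M.admissibleCost_nonneg hx r)
    (fun z t ht x hx => M.admissibleCost_smul ht hx r) hC hle hcont
  refine ⟨fun v => (h1 v).congr (hunit v).symm, ?_⟩
  have hconst : M.tailConst μ K α u e₁ ξ r = K * ∑ v, ∫ ω,
      M.admissibleCost r (Pi.single v 1, u ω, e₁ ω, fun i => ξ i ω) ^ α ∂μ := by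
    unfold tailConst
    simp only [fun v => integral_congr_ae (hunit v)]
  rw [hconst]
  refine h2.congr fun y => ?_
  congr 1
  have hae := M.ae_congestionCost_eq hX_nonneg hnoise r
  exact le_antisymm (measureReal_mono_of_ae (hae.mono fun ω hω h => lt_of_lt_of_eq h hω.symm))
    (measureReal_mono_of_ae (hae.mono fun ω hω h => lt_of_lt_of_eq h hω))

/-- For v sending traffic to another vertex, some edge carries flow under the unit weight at v; it
is the initial edge with positive probability, and then the cost is positive. -/
lemma tailConst_pos (hQ : ∃ v w, v ≠ w ∧ 0 < M.Q w v) (hK : 0 < K)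
    (hnoise : M.IsCascadeNoise μ u e₁ ξ) {r : ℕ} (hr : 1 ≤ r)
    (hint : ∀ v, Integrable (fun ω => M.unitCost v u e₁ ξ r ω ^ α) μ) :
    0 < M.tailConst μ K α u e₁ ξ r := by
  obtain ⟨v, w, hvw, hQ⟩ := hQ
  have hs : ∀ v, (0 : V → ℝ) ≤ Pi.single v 1 := fun v => Pi.single_nonneg.2 zero_le_one
  have hs0 : (Pi.single v 1 : V → ℝ) ≠ 0 := Pi.single_ne_zero_iff.2 one_ne_zero
  have hnn : ∀ v, 0 ≤ᵐ[μ] fun ω => M.unitCost v u e₁ ξ r ω ^ α := fun v => by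
    filter_upwards [hnoise.u_mem] with ω hω
    exact Real.rpow_nonneg (M.congestionCost_nonneg (hs v) hω r) _
  refine mul_pos hK (Finset.sum_pos' (fun v _ => integral_nonneg_of_ae (hnn v))
    ⟨v, Finset.mem_univ v, ?_⟩)
  rw [integral_pos_iff_support_of_nonneg_ae (hnn v) (hint v)]
  obtain ⟨e, he⟩ := M.exists_wardropFlow_pos hvw hQ (M.capacity₀_nonneg (hs v))
  have hpos : 0 < μ {ω | e₁ ω = e} := by
    rw [hnoise.e₁_uniform]
    exact ENNReal.inv_pos.2 (ENNReal.natCast_ne_top _)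
  refine hpos.trans_le (measure_mono_ae ?_)
  filter_upwards [hnoise.u_mem] with ω hω h
  have h' : e₁ ω = e := h
  exact (Real.rpow_pos_of_pos
    (M.congestionCost_pos (hs v) hs0 hω hr (by rw [h']; exact he)) α).ne'

end Main

end TrafficModel

theorem theorem1 {V : Type*} [Fintype V] (M : TrafficModel V)
    (hQ : ∃ v w, v ≠ w ∧ 0 < M.Q w v)
    {Ω : Type*} [MeasurableSpace Ω] (μ : Measure Ω) [IsProbabilityMeasure μ]
    (α K : ℝ) (hα : 0 < α) (hK : 0 < K)
    (X : V → Ω → ℝ) (hX_meas : ∀ v, Measurable (X v)) (hX_nonneg : ∀ v, ∀ᵐ ω ∂μ, 0 ≤ X v ω)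
    (hX_indep : iIndepFun X μ)
    (hX_tail : ∀ v, (fun x : ℝ => μ.real {ω | x < X v ω}) ~[atTop] fun x => K * x ^ (-α))
    (u : Ω → ℝ) (e₁ : Ω → M.Edge) (ξ : ℕ × M.Edge → Ω → ℝ)
    (hnoise : M.IsCascadeNoise μ u e₁ ξ)
    (hindep : IndepFun (fun ω v => X v ω) (fun ω => (u ω, e₁ ω, fun i => ξ i ω)) μ) :
    (∀ r : ℕ, 1 ≤ r →
      AEMeasurable (fun ω => M.congestionCost (fun v => X v ω) (u ω) (e₁ ω) (fun i => ξ i ω) r) μ ∧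
      (∀ v, Integrable (fun ω => M.unitCost v u e₁ ξ r ω ^ α) μ) ∧
      0 < M.tailConst μ K α u e₁ ξ r ∧
      (fun y : ℝ => μ.real
          {ω | y < M.congestionCost (fun v => X v ω) (u ω) (e₁ ω) (fun i => ξ i ω) r})
        ~[atTop] fun y => M.tailConst μ K α u e₁ ξ r * y ^ (-α)) ∧
    AEMeasurable (fun ω => M.congestionCostEnd (fun v => X v ω) (u ω) (e₁ ω) (fun i => ξ i ω)) μ ∧
    ∃ Cend : ℝ, Tendsto (fun r => M.tailConst μ K α u e₁ ξ r) atTop (𝓝 Cend) ∧ 0 < Cend ∧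
      (fun y : ℝ => μ.real
          {ω | y < M.congestionCostEnd (fun v => X v ω) (u ω) (e₁ ω) (fun i => ξ i ω)})
        ~[atTop] fun y => Cend * y ^ (-α) := by
  have htail := M.integrable_and_tendsto_congestionCost_tail hα hK hX_meas hX_nonneg hX_indep
    hX_tail hnoise hindep
  have hpos : ∀ r, 1 ≤ r → 0 < M.tailConst μ K α u e₁ ξ r := fun r hr =>
    M.tailConst_pos hQ hK hnoise hr (htail r).1
  obtain ⟨N, hN⟩ : ∃ N, ∀ (x : V → ℝ) (u : ℝ) (e₁ : M.Edge) (ξ : ℕ × M.Edge → ℝ),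
      1 ≤ N ∧ M.congestionCostEnd x u e₁ ξ = M.congestionCost x u e₁ ξ N ∧
      ∀ s, N ≤ s → M.congestionCost x u e₁ ξ s = M.congestionCost x u e₁ ξ N := by
    classical
    -- The stage N is the successor of ∑ n_e, the same for all weights and noise.
    exact ⟨_, fun x u e₁ ξ => ⟨Nat.succ_le_succ (Nat.zero_le _),
      M.congestionCostEnd_eq (Nat.lt_succ_self _),
      fun s hs => M.congestionCost_eq_of_le (Nat.lt_succ_self _) hs⟩⟩
  -- An edge is needed to instantiate `hN`; it is taken from the random initial edge at any sample
  -- point.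
  have hN1 : 1 ≤ N := by
    obtain ⟨ω⟩ : Nonempty Ω := nonempty_of_isProbabilityMeasure μ
    exact (hN 0 0 (e₁ ω) 0).1
  refine ⟨fun r hr => ⟨M.aemeasurable_congestionCost hX_meas hX_nonneg hnoise r, (htail r).1,
    hpos r hr, isEquivalent_of_tendsto_rpow_mul (hpos r hr).ne' (htail r).2⟩, ?_, ?_⟩
  · simp only [(hN _ _ _ _).2.1]
    exact M.aemeasurable_congestionCost hX_meas hX_nonneg hnoise N
  · refine ⟨M.tailConst μ K α u e₁ ξ N, ?_, hpos N hN1, ?_⟩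
    · refine tendsto_const_nhds.congr' ?_
      filter_upwards [eventually_ge_atTop N] with r hr
      simp only [TrafficModel.tailConst, TrafficModel.unitCost, (hN _ _ _ _).2.2 r hr]
    · simp only [(hN _ _ _ _).2.1]
      exact isEquivalent_of_tendsto_rpow_mul (hpos N hN1).ne' (htail N).2
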